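/- Let $q$ be a power of a prime $p$, let $U=\mathrm{UD}_6(q)$ be the group generated by the root subgroups $X_\alpha=\{x_\alpha(t)\mid t\in\mathbb F_q\}$, $\alpha\in\Phi^+$, in the finite Chevalley group of type $\mathrm D_6$ over $\mathbb F_q$ (a Sylow $p$-subgroup), and let $\alpha_1,\dots,\alpha_{30}$ be the positive roots, ordered by height. Let $\mathcal S=\{\alpha_1,\dots,\alpha_{24}\}$ be the set of the positive roots of height at most $5$ and $\mathcal Z=\{\alpha_{21},\alpha_{22},\alpha_{23},\alpha_{24}\}$ the set of those of height $5$ (this is the $[4,24,43]$-core: $|\mathcal Z|=4$, $|\mathcal S|=24$, and $43$ unordered pairs of roots in $\mathcal S$ have their sum in $\mathcal S$). Let $X_{\mathcal S}=U/\prod_{\alpha\notin\mathcal S}X_\alpha$, and let $\operatorname{Irr}(X_{\mathcal S})_{\mathcal Z}$ be the set of the irreducible complex characters $\chi$ of $X_{\mathcal S}$ with $X_\alpha\not\subseteq\ker\chi$ for all $\alpha\in\mathcal Z$. - If $p\neq 2$, then $\operatorname{Irr}(X_{\mathcal S})_{\mathcal Z}=\mathcal F^1\sqcup\mathcal F^2\sqcup\mathcal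 F^3$, where $\mathcal F^1$ consists of $q(q-1)^5$ characters of degree $q^9$, $\mathcal F^2$ of $(q-1)^5$ characters of degree $q^9$, and $\mathcal F^3$ of $q^2(q-1)^4$ characters of degree $q^8$. - If $p=2$, then $\operatorname{Irr}(X_{\mathcal S})_{\mathcal Z}=\mathcal F^1\sqcup\mathcal F^2\sqcup\mathcal F^3\sqcup\mathcal F^4$, where $\mathcal F^1$ consists of $4q(q-1)^5$ characters of degree $q^9/2$, $\mathcal F^2$ of $q^2(q-1)^5$ characters of degree $q^8$, $\mathcal F^3$ of $q(q-1)^4$ characters of degree $q^8$, and $\mathcal F^4$ of $4q(q-1)^5$ characters of degree $q^8/2$. Moreover, each family is parametrized bijectively by labels $(\ell,a)$ with $a=(a_{21},a_{22},a_{23},a_{24})\in(\mathbb F_q^\times)^4$ and $\ell\in L$, where $L$ is $\mathbb F_q\times\mathbb F_q^\times$, $\mathbb F_q^\times$, $\mathbb F_q^2$ for $\mathcal F^1,\mathcal F^2,\mathcal F^3$ if $p\ne2$, and $\mathbb F_2\times\mathbb F_q\times\mathbb F_2\times\mathbb F_q^\times$, $\mathbb F_q^2\times\mathbb F_q^\times$,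 $\mathbb F_q$, $\mathbb F_q\times\mathbb F_2^2\times\mathbb F_q^\times$ for $\mathcal F^1,\dots,\mathcal F^4$ if $p=2$, in such a way that the character $\chi$ with label $(\ell,a)$ satisfies $\chi(x_{\alpha_i}(t))=\chi(1)\,e^{2\pi\sqrt{-1}\,\operatorname{Tr}(a_it)/p}$ for $i=21,\dots,24$ and $t\in\mathbb F_q$, where $\operatorname{Tr}:\mathbb F_q\to\mathbb F_p$ is the trace. -/

import Mathlib

/-! ### The positive roots of type `D₆` -/

/-- A positive root of type `D₆`: the triple `(i, j, s)` with `i < j` stands for `e_i + e_j` if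
`s = true` and for `e_i - e_j` if `s = false`, where `e_0, …, e_5` is the standard basis. -/
abbrev PosRoot : Type := {r : Fin 6 × Fin 6 × Bool // r.1 < r.2.1}

namespace PosRoot

/-- The root as a vector of `ℤ⁶`. -/
def vec (α : PosRoot) : Fin 6 → ℤ := fun k =>
  (if k = α.1.1 then 1 else 0) + (if k = α.1.2.1 then (if α.1.2.2 then 1 else -1) else 0)

/-- `α + β = γ` in the root lattice. -/
def IsSum (α β γ : PosRoot) : Prop := ∀ k, α.vec k + β.vec k = γ.vec k

/-- A numerical code of a root, used only to decide `IsSum` quickly. -/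
def code (α : PosRoot) : ℕ :=
  if α.1.2.2 then 7 ^ (5 - α.1.1.val) + 7 ^ (5 - α.1.2.1.val)
  else 7 ^ (5 - α.1.1.val) - 7 ^ (5 - α.1.2.1.val)

theorem code_eq (α : PosRoot) : (α.code : ℤ) =
    16807 * α.vec 0 + 2401 * α.vec 1 + 343 * α.vec 2 + 49 * α.vec 3 + 7 * α.vec 4 + α.vec 5 := by
  revert α; decide +kernel

theorem vec_bound (α : PosRoot) (k : Fin 6) : -1 ≤ α.vec k ∧ α.vec k ≤ 1 := by
  revert α k; decide +kernel

theorem isSum_iff_code (α β γ : PosRoot) : α.code + β.code = γ.code ↔ IsSum α β γ := by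
  have hα := α.code_eq
  have hβ := β.code_eq
  have hγ := γ.code_eq
  constructor
  · intro h k
    have a := α.vec_bound
    have b := β.vec_bound
    have c := γ.vec_bound
    have a0 := a 0; have a1 := a 1; have a2 := a 2; have a3 := a 3; have a4 := a 4; have a5 := a 5
    have b0 := b 0; have b1 := b 1; have b2 := b 2; have b3 := b 3; have b4 := b 4; have b5 := b 5
    have c0 := c 0; have c1 := c 1; have c2 := c 2; have c3 := c 3; have c4 := c 4; have c5 := c 5
    have e0 : α.vec 0 + β.vec 0 = γ.vec 0 := by omega
    have e1 : α.vec 1 + β.vec 1 = γ.vec 1 := by omega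
    have e2 : α.vec 2 + β.vec 2 = γ.vec 2 := by omega
    have e3 : α.vec 3 + β.vec 3 = γ.vec 3 := by omega
    have e4 : α.vec 4 + β.vec 4 = γ.vec 4 := by omega
    have e5 : α.vec 5 + β.vec 5 = γ.vec 5 := by omega
    fin_cases k <;> assumption
  · intro h
    have h0 := h 0; have h1 := h 1; have h2 := h 2; have h3 := h 3; have h4 := h 4; have h5 := h 5
    omega

instance (α β γ : PosRoot) : Decidable (IsSum α β γ) :=
  decidable_of_iff _ (isSum_iff_code α β γ)

/-- The six simple roots: `e_k - e_{k+1}` for `k < 5`, and `e_4 + e_5`. -/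
def simple : Fin 6 → PosRoot :=
  ![⟨(0, 1, false), by decide⟩, ⟨(1, 2, false), by decide⟩, ⟨(2, 3, false), by decide⟩,
    ⟨(3, 4, false), by decide⟩, ⟨(4, 5, false), by decide⟩, ⟨(4, 5, true), by decide⟩]

/-- The height of a root: its pairing with `(5, 4, 3, 2, 1, 0)`, which takes the value `1` on
every simple root, so that it is the sum of the coefficients in the simple roots. -/
def height (α : PosRoot) : ℤ := ∑ k : Fin 6, (5 - (k : ℕ) : ℤ) * α.vec k

theorem height_simple (k : Fin 6) : (simple k).height = 1 := by
  revert k; decide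

theorem height_pos (α : PosRoot) : 1 ≤ α.height := by
  revert α; decide +kernel

theorem IsSum.height_eq {α β γ : PosRoot} (h : IsSum α β γ) :
    γ.height = α.height + β.height := by
  simp only [height, ← Finset.sum_add_distrib, ← mul_add, h _]

end PosRoot

/-! ### Quatterns -/

/-- A pattern `P` of positive roots together with a normal subpattern `K`; the quattern is the
set `P \ K`. -/
structure Quattern where
  P : Finset PosRoot
  K : Finset PosRoot
  subset : K ⊆ P
  pattern_P : ∀ α ∈ P, ∀ β ∈ P, ∀ γ, PosRoot.IsSum α β γ → γ ∈ P
  pattern_K : ∀ α ∈ K, ∀ β ∈ K, ∀ γ, PosRoot.IsSum α β γ → γ ∈ K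
  normal : ∀ δ ∈ K, ∀ β ∈ P, ∀ γ ∈ P, PosRoot.IsSum δ β γ → γ ∈ K

namespace Quattern

/-- The quattern `S = P \ K`. -/
def S (Q : Quattern) : Finset PosRoot := Q.P \ Q.K

/-- The central roots `Z(S)`. -/
def centralRoots (Q : Quattern) : Finset PosRoot :=
  Q.S.filter fun γ => ∀ α ∈ Q.S, ∀ β ∈ Q.S, ¬ PosRoot.IsSum γ α β

/-- The roots `D(S)` whose root subgroups are direct factors. -/
def directRoots (Q : Quattern) : Finset PosRoot :=
  Q.centralRoots.filter fun γ => ∀ α ∈ Q.S, ∀ β ∈ Q.S, ¬ PosRoot.IsSum α β γ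

/-- `(β, δ)` is a pair (arm, leg) at `γ ∈ Z` to which the elementary reduction lemma applies:
`δ + β = γ`, `β` is not a sum of two roots of `S`, and `δ + α ∉ S` for all `α ∈ S \ {β}`. -/
def IsReducingPair (Q : Quattern) (Z : Finset PosRoot) (β δ : PosRoot) : Prop :=
  ∃ γ ∈ Z, β ∈ Q.S ∧ δ ∈ Q.S ∧ β ≠ γ ∧ δ ≠ γ ∧ PosRoot.IsSum δ β γ ∧
    (∀ α ∈ Q.S, ∀ α' ∈ Q.S, ¬ PosRoot.IsSum α α' β) ∧
    (∀ α ∈ Q.S, α ≠ β → ∀ ε ∈ Q.S, ¬ PosRoot.IsSum δ α ε)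

/-- `(S, Z)` is a nonabelian core, i.e. the reduction algorithm stops at `(S, Z)` and `S` is not
abelian. -/
def IsNonabelianCore (Q : Quattern) (Z : Finset PosRoot) : Prop :=
  Z ⊆ Q.centralRoots ∧ Q.S ≠ Q.centralRoots ∧ (∀ β δ, ¬ Q.IsReducingPair Z β δ) ∧
    Q.centralRoots \ (Z ∪ Q.directRoots) = ∅

/-- The number of unordered pairs of roots in `S` whose sum is in `S`. -/
def numSums (Q : Quattern) : ℕ :=
  ((Q.S ×ˢ Q.S ×ˢ Q.S).filter fun t => PosRoot.IsSum t.1 t.2.1 t.2.2).card / 2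

end Quattern

/-! ### The quattern of the `[4,24,43]`-core -/

/-- The quattern of the roots of height at most `5`: these are the first `24` positive roots
`α₁, …, α₂₄` in any total ordering of the `30` positive roots by height. -/
def coreD6 : Quattern where
  P := Finset.univ
  K := Finset.univ.filter fun α => 6 ≤ α.height
  subset := Finset.subset_univ _
  pattern_P := fun _ _ _ _ _ _ => Finset.mem_univ _
  pattern_K := fun α hα β _ γ h => by
    have h1 := h.height_eq
    have h2 := β.height_pos
    simp only [Finset.mem_filter, Finset.mem_univ, true_and] at hα ⊢
    omega
  normal := fun α hα β _ γ _ h => by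
    have h1 := h.height_eq
    have h2 := β.height_pos
    simp only [Finset.mem_filter, Finset.mem_univ, true_and] at hα ⊢
    omega

/-- The roots `α₂₁, …, α₂₄` of height `5`, namely `e_0 - e_5`, `e_0 + e_5`, `e_1 + e_4` and
`e_2 + e_3`. -/
def coreZ : Finset PosRoot := Finset.univ.filter fun α => α.height = 5

/-- The roots `α₁, …, α₂₄` in increasing order. -/
def coreList : List PosRoot :=
  [⟨(0, 1, false), by decide⟩, ⟨(1, 2, false), by decide⟩, ⟨(2, 3, false), by decide⟩,
    ⟨(3, 4, false), by decide⟩, ⟨(4, 5, false), by decide⟩, ⟨(4, 5, true), by decide⟩,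
    ⟨(0, 2, false), by decide⟩, ⟨(1, 3, false), by decide⟩, ⟨(2, 4, false), by decide⟩,
    ⟨(3, 5, false), by decide⟩, ⟨(3, 5, true), by decide⟩, ⟨(0, 3, false), by decide⟩,
    ⟨(1, 4, false), by decide⟩, ⟨(2, 5, false), by decide⟩, ⟨(2, 5, true), by decide⟩,
    ⟨(3, 4, true), by decide⟩, ⟨(0, 4, false), by decide⟩, ⟨(1, 5, false), by decide⟩,
    ⟨(1, 5, true), by decide⟩, ⟨(2, 4, true), by decide⟩, ⟨(0, 5, false), by decide⟩,
    ⟨(0, 5, true), by decide⟩, ⟨(1, 4, true), by decide⟩, ⟨(2, 3, true), by decide⟩]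

theorem coreD6_S : coreD6.S = ⟨coreList, by decide +kernel⟩ := by decide +kernel

theorem coreD6_form : coreZ.card = 4 ∧ coreD6.S.card = 24 ∧ coreD6.numSums = 43 := by
  refine ⟨by decide +kernel, by rw [coreD6_S]; decide +kernel, ?_⟩
  rw [Quattern.numSums, coreD6_S]
  decide +kernel

theorem coreZ_eq : coreZ = ⟨coreList.drop 20, by decide +kernel⟩ := by decide +kernel

theorem coreD6_centralRoots : coreD6.centralRoots = coreZ := by
  rw [Quattern.centralRoots, coreD6_S, coreZ_eq]
  decide +kernel

theorem coreD6_directRoots : coreD6.directRoots = ∅ := by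
  rw [Quattern.directRoots, coreD6_centralRoots, coreD6_S, coreZ_eq]
  decide +kernel

set_option synthInstance.maxSize 2000 in
set_option synthInstance.maxHeartbeats 200000 in
theorem coreD6_isNonabelianCore : coreD6.IsNonabelianCore coreZ := by
  refine ⟨by rw [coreD6_centralRoots], fun h => ?_, ?_, by simp [coreD6_centralRoots]⟩
  · have h1 := coreD6_form
    rw [h, coreD6_centralRoots] at h1
    omega
  · have key : ∀ β ∈ coreD6.S, ∀ δ ∈ coreD6.S, ¬ coreD6.IsReducingPair coreZ β δ := by
      unfold Quattern.IsReducingPair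
      rw [coreD6_S, coreZ_eq]
      decide +kernel
    intro β δ h
    have h' := h
    obtain ⟨γ, _, hβ, hδ, _⟩ := h'
    exact key β hβ δ hδ h

/-! ### Root subgroups of the finite group `D₆(q)` and quattern groups -/

section Groups

variable (F : Type*) [Field F]

/-- The root vector of the positive root `α` in the orthogonal Lie algebra of type `D₆` acting on
the `12`-dimensional space with basis `v_0, …, v_5` (of weights `e_0, …, e_5`, indexed by
`Sum.inl`) and `v_{-0}, …, v_{-5}` (of weights `-e_0, …, -e_5`, indexed by `Sum.inr`), which
carries the quadratic form `∑ x_i x_{-i}`. -/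
def rootVector (α : PosRoot) : Matrix (Fin 6 ⊕ Fin 6) (Fin 6 ⊕ Fin 6) F :=
  if α.1.2.2 then
    Matrix.single (Sum.inl α.1.1) (Sum.inr α.1.2.1) 1
      - Matrix.single (Sum.inl α.1.2.1) (Sum.inr α.1.1) 1
  else
    Matrix.single (Sum.inl α.1.1) (Sum.inl α.1.2.1) 1
      - Matrix.single (Sum.inr α.1.2.1) (Sum.inr α.1.1) 1

theorem rootVector_mul_self (α : PosRoot) : rootVector F α * rootVector F α = 0 := by
  obtain ⟨⟨i, j, s⟩, h⟩ := α
  have h1 : i ≠ j := ne_of_lt h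
  have h2 : j ≠ i := h1.symm
  cases s <;> simp [rootVector, sub_mul, mul_sub, h1, h2]

variable {F}

/-- The root element `x_α(t) = 1 + t e_α = exp (t e_α)`, as an element of `GL₁₂(F)`. -/
def rootElt (α : PosRoot) (t : F) : GL (Fin 6 ⊕ Fin 6) F where
  val := 1 + t • rootVector F α
  inv := 1 - t • rootVector F α
  val_inv := by simp [mul_sub, add_mul, rootVector_mul_self]
  inv_val := by simp [mul_add, sub_mul, rootVector_mul_self]

variable (F)

/-- The subgroup `X_A` generated by the root subgroups `X_α = {x_α(t) | t ∈ F}`, `α ∈ A`. If `A` is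
a pattern, it is the product of these root subgroups; if `A` consists of all positive roots, it is
the group `U = UD₆(q)`. -/
def rootSubgroup (A : Finset PosRoot) : Subgroup (GL (Fin 6 ⊕ Fin 6) F) :=
  Subgroup.closure {g | ∃ α ∈ A, ∃ t : F, g = rootElt α t}

variable {F}

theorem rootElt_mem {A : Finset PosRoot} {α : PosRoot} (h : α ∈ A) (t : F) :
    rootElt α t ∈ rootSubgroup F A := Subgroup.subset_closure ⟨α, h, t, rfl⟩


theorem rootElt_inv (α : PosRoot) (t : F) : (rootElt α t)⁻¹ = rootElt α (-t) := by
  ext1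
  change (1 : Matrix _ _ F) - t • rootVector F α = 1 + (-t) • rootVector F α
  simp [sub_eq_add_neg]


theorem single_mul_single_ite {I : Type*} [Fintype I] [DecidableEq I] (a b c d : I) :
    Matrix.single a b (1 : F) * Matrix.single c d 1 = if b = c then Matrix.single a d 1 else 0 := by
  split_ifs with h
  · subst h; simp
  · simp [h]

theorem rootVector_mul_mul (α β : PosRoot) :
    rootVector F α * rootVector F β * rootVector F α = 0 := by
  obtain ⟨⟨i, j, s⟩, h⟩ := α
  obtain ⟨⟨k, l, u⟩, h'⟩ := β
  change i < j at h
  change k < l at h'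
  cases s <;> cases u <;>
    simp only [rootVector, sub_mul, mul_sub, single_mul_single_ite, ite_mul, zero_mul,
      Sum.inl.injEq, Sum.inr.injEq, reduceCtorEq, if_true, if_false, ite_self, sub_self, sub_zero,
      zero_sub, Bool.false_eq_true] <;> (try split_ifs) <;> (try simp) <;> (try omega) <;>
    (try simp_all)
  rw [single_mul_single_ite, if_neg]
  simp
  omega

theorem rootVector_comm_aux (α β : PosRoot) (hα : α.1.2.2 = false) :
    rootVector F α * rootVector F β = rootVector F β * rootVector F α ∨
      ∃ γ, PosRoot.IsSum α β γ ∧ ∃ ε : F,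
        rootVector F α * rootVector F β - rootVector F β * rootVector F α = ε • rootVector F γ := by
  obtain ⟨⟨i, j, s⟩, h⟩ := α
  obtain ⟨⟨k, l, u⟩, h'⟩ := β
  change i < j at h
  change k < l at h'
  change s = false at hα
  subst hα
  cases u
  · by_cases hjk : j = k
    · subst hjk
      have hl : l ≠ i := by omega
      refine Or.inr ⟨⟨(i, l, false), h.trans h'⟩, fun m => ?_, 1, ?_⟩
      · simp only [PosRoot.vec]; grind
      · simp [rootVector, sub_mul, mul_sub, hl, hl.symm]
    · by_cases hil : i = l
      · subst hil
        refine Or.inr ⟨⟨(k, j, false), h'.trans h⟩, fun m => ?_, -1, ?_⟩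
        · simp only [PosRoot.vec]; grind
        · simp [rootVector, sub_mul, mul_sub, hjk, Ne.symm hjk]
      · left
        simp [rootVector, sub_mul, mul_sub, hjk, Ne.symm hjk, hil,
          Ne.symm hil]
  · by_cases hjk : j = k
    · subst hjk
      have hl : l ≠ j := by omega
      refine Or.inr ⟨⟨(i, l, true), h.trans h'⟩, fun m => ?_, 1, ?_⟩
      · simp only [PosRoot.vec]; grind
      · simp [rootVector, sub_mul, mul_sub, hl, hl.symm]
    · by_cases hjl : j = l
      · subst hjl
        rcases lt_trichotomy i k with hik | hik | hik
        · refine Or.inr ⟨⟨(i, k, true), hik⟩, fun m => ?_, -1, ?_⟩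
          · simp only [PosRoot.vec]; grind
          · simp [rootVector, sub_mul, mul_sub, hjk, Ne.symm hjk]
            try abel
        · subst hik
          left
          simp [rootVector, sub_mul, mul_sub, hjk, Ne.symm hjk]
        · refine Or.inr ⟨⟨(k, i, true), hik⟩, fun m => ?_, 1, ?_⟩
          · simp only [PosRoot.vec]; grind
          · simp [rootVector, sub_mul, mul_sub, hjk, Ne.symm hjk]
            try abel
      · left
        simp [rootVector, sub_mul, mul_sub, hjk, Ne.symm hjk, hjl,
          Ne.symm hjl]

/-- The commutator of two root vectors is a multiple of the root vector of the sum. -/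
theorem rootVector_comm (α β : PosRoot) :
    rootVector F α * rootVector F β = rootVector F β * rootVector F α ∨
      ∃ γ, PosRoot.IsSum α β γ ∧ ∃ ε : F,
        rootVector F α * rootVector F β - rootVector F β * rootVector F α = ε • rootVector F γ := by
  cases hα : α.1.2.2
  · exact rootVector_comm_aux α β hα
  · cases hβ : β.1.2.2
    · rcases rootVector_comm_aux (F := F) β α hβ with h | ⟨γ, h, ε, h'⟩
      · exact Or.inl h.symm
      · refine Or.inr ⟨γ, fun k => by rw [add_comm, h k], -ε, ?_⟩
        rw [neg_smul, ← h', neg_sub]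
    · left; simp [rootVector, hα, hβ, sub_mul, mul_sub]

theorem rootElt_conj_mem (Q : Quattern) {α β : PosRoot} (hα : α ∈ Q.P) (hβ : β ∈ Q.K) (s t : F) :
    rootElt α s * rootElt β t * (rootElt α s)⁻¹ ∈ rootSubgroup F Q.K := by
  have haa := rootVector_mul_self F α
  have haba := rootVector_mul_mul (F := F) α β
  have hbab := rootVector_mul_mul (F := F) β α
  have hconj : ((rootElt α s * rootElt β t * (rootElt α s)⁻¹ : GL (Fin 6 ⊕ Fin 6) F) :
      Matrix (Fin 6 ⊕ Fin 6) (Fin 6 ⊕ Fin 6) F) = 1 + t • rootVector F β + (s * t) •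
        (rootVector F α * rootVector F β - rootVector F β * rootVector F α) := by
    change (1 + s • rootVector F α) * (1 + t • rootVector F β) * (1 - s • rootVector F α) = _
    simp only [add_mul, mul_sub, mul_add, one_mul, mul_one, smul_mul_assoc, mul_smul_comm, haa,
      haba, smul_zero]
    module
  rcases rootVector_comm (F := F) α β with h | ⟨γ, h, ε, h'⟩
  · have : rootElt α s * rootElt β t * (rootElt α s)⁻¹ = rootElt β t := by
      ext1
      rw [hconj, h, sub_self, smul_zero, add_zero]
      rfl
    rw [this]
    exact rootElt_mem hβ t
  · have hγ : γ ∈ Q.K := Q.normal β hβ α hα γ (Q.pattern_P α hα β (Q.subset hβ) γ h)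
      fun k => by rw [add_comm, h k]
    have : rootElt α s * rootElt β t * (rootElt α s)⁻¹
        = rootElt γ (s * t * ε) * rootElt β t := by
      have hcb : (ε • rootVector F γ) * rootVector F β = 0 := by
        rw [← h', sub_mul, hbab, mul_assoc, rootVector_mul_self, mul_zero, sub_zero]
      ext1
      rw [hconj, h']
      change _ = (1 + (s * t * ε) • rootVector F γ) * (1 + t • rootVector F β)
      rw [mul_smul (s * t) ε, add_mul, smul_mul_assoc, mul_add (ε • rootVector F γ),
        mul_smul_comm t, hcb, smul_zero, add_zero, mul_one, one_mul]
    rw [this]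
    exact mul_mem (rootElt_mem hγ _) (rootElt_mem hβ t)

/-- `X_K` is normal in `X_P`. -/
instance rootSubgroup_normal (Q : Quattern) :
    ((rootSubgroup F Q.K).subgroupOf (rootSubgroup F Q.P)).Normal := by
  have hle : rootSubgroup F Q.K ≤ rootSubgroup F Q.P :=
    Subgroup.closure_mono fun _ ⟨α, h, t, e⟩ => ⟨α, Q.subset h, t, e⟩
  rw [Subgroup.normal_subgroupOf_iff_le_normalizer hle]
  have key : ∀ α ∈ Q.P, ∀ s : F, ∀ g ∈ rootSubgroup F Q.K,
      rootElt α s * g * (rootElt α s)⁻¹ ∈ rootSubgroup F Q.K := by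
    intro α hα s g hg
    have : rootSubgroup F Q.K ≤
        (rootSubgroup F Q.K).comap (MulAut.conj (rootElt α s)).toMonoidHom := by
      conv_lhs => rw [rootSubgroup]
      rw [Subgroup.closure_le]
      rintro _ ⟨β, hβ, t, rfl⟩
      exact rootElt_conj_mem Q hα hβ s t
    exact this hg
  conv_lhs => rw [rootSubgroup]
  rw [Subgroup.closure_le]
  rintro _ ⟨α, hα, s, rfl⟩
  rw [SetLike.mem_coe, Subgroup.mem_normalizer_iff]
  refine fun g => ⟨key α hα s g, fun hg => ?_⟩
  have := key α hα (-s) _ hg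
  rw [← rootElt_inv] at this
  simpa [mul_assoc] using this

end Groups

/-- The quattern group `X_S = X_P / X_K`. -/
abbrev QuatternGroup (Q : Quattern) (F : Type*) [Field F] : Type _ :=
  rootSubgroup F Q.P ⧸ (rootSubgroup F Q.K).subgroupOf (rootSubgroup F Q.P)

/-- The image of the root element `x_α(t)` in the quattern group. -/
def QuatternGroup.x (Q : Quattern) {F : Type*} [Field F] (α : Q.P) (t : F) : QuatternGroup Q F :=
  QuotientGroup.mk ⟨rootElt α.1 t, rootElt_mem α.2 t⟩

/-! ### Irreducible characters -/

/-- The set `Irr(G)` of (ordinary) irreducible characters of `G`. -/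
def Irr (G : Type*) [Group G] : Set (G → ℂ) :=
  {χ | ∃ (n : ℕ) (ρ : Representation ℂ G (Fin n → ℂ)), ρ.IsIrreducible ∧ χ = ρ.character}

/-- The set `Irr(X_S)_Z` of the irreducible characters of `X_S` whose kernel contains no root
subgroup `X_α` with `α ∈ Z`. -/
def IrrCentral (Q : Quattern) (Z : Finset PosRoot) (F : Type*) [Field F] :
    Set (QuatternGroup Q F → ℂ) :=
  {χ | χ ∈ Irr (QuatternGroup Q F) ∧
    ∀ α : Q.P, α.1 ∈ Z → ∃ t : F, χ (QuatternGroup.x Q α t) ≠ χ 1}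

/-- The additive character `φ(t) = exp(2πi Tr(t) / p)` of a finite field of characteristic `p`. -/
noncomputable def phi (p : ℕ) [NeZero p] {F : Type*} [Field F] [Algebra (ZMod p) F] (t : F) : ℂ :=
  ZMod.stdAddChar (Algebra.trace (ZMod p) F t)

/-- `𝓕` is a family of `N` characters of degree `D` of the quattern group of `coreD6`, which is
parametrized bijectively by the labels `(ℓ, a)`, where `ℓ ∈ L` and `a = (a₂₁, a₂₂, a₂₃, a₂₄)` runs
over the quadruples of elements of `Fˣ`, such that the character with label `(ℓ, a)` restricts to
the central root subgroup `X_γ`, `γ ∈ Z`, as the multiple of degree `D` of the linear character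
`x_γ(t) ↦ φ(a_γ t)`. -/
structure IsFamily (p : ℕ) [NeZero p] (F : Type*) [Field F] [Algebra (ZMod p) F] (L : Type*)
    (N : ℕ) (D : ℂ) (𝓕 : Set (QuatternGroup coreD6 F → ℂ)) : Prop where
  card_eq : 𝓕.ncard = N
  degree_eq : ∀ χ ∈ 𝓕, χ 1 = D
  labels : ∃ χ : L × (coreZ → Fˣ) → (QuatternGroup coreD6 F → ℂ),
    Function.Injective χ ∧ Set.range χ = 𝓕 ∧
      ∀ ℓ a, ∀ γ : coreZ, ∀ t : F,
        χ (ℓ, a) (QuatternGroup.x coreD6 ⟨γ.1, Finset.mem_univ _⟩ t) = D * phi p (a γ * t : F)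

/-! ### Induced characters of linear characters -/

section RepresentationTheory

open Representation

/-! Cutting the 12 × 12 matrices into 3 × 3 blocks describes an element of the quattern group by
unitriangular matrices g and k, a matrix m, and the coordinates p, s of an alternating matrix
(`coordEquiv`). The four root subgroups of height 5 are the central coordinates m00, s00, s11, s22.
A torus automorphism turns the parameters on s00, s11, s22 into 1, so only a = a₂₁/a₂₂ on m00
remains (`normalizedEquiv`).

The rest is Clifford theory. On the abelian normal subgroup of the p, s, the stabilizer of the
character ψ(tr s) is given by k = g and m symmetric. Characters of the additive group of symmetric
matrices are ternary quadratic forms, which differ from symmetric bilinear forms in characteristic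
2; this is why p = 2 is special. The unitriangular group acts on forms by substitution and fixes the
leading coefficient a. So one expects a character for each orbit of forms with leading coefficient a
and each linear character of the stabilizer, of degree q⁹/|Stab|. All of them are induced from
linear characters of `stabGroup`.

Instead of using Clifford theory twice, `intertwine` determines all elements that intertwine two
such linear characters, and Mackey's formula gives both irreducibility and distinctness.
Completeness is a degree count (`exists_eq_indChar`): the squares of the degrees must add up to q²⁰,
the index of the central subgroup, i.e. the sum of 1/|Stab|² over the labels must be q². This is the
orbit formula for a group of order q³ acting on q⁵ forms with abelian stabilizers.

It remains to find the orbits. For p odd, completing the square leaves a binary form b x₁² + c x₁x₂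
+ d x₂² under x₁ ↦ x₁ + t x₂, and the three families are b ≠ 0; b = 0 ≠ c; b = c = 0. For p = 2, the
coefficient u of x₀x₁ is invariant. If u ≠ 0, then b matters only modulo the values a r² + u r, a
subgroup of index 2. If u = 0, then b can be removed, and the cases c ≠ 0; c = v = 0; c = 0 ≠ v give
the other families, the last with an Artin–Schreier class again. -/

/-- By Maschke, an invariant subspace has an invariant complement. The projection along it is an
intertwiner, hence a scalar, so the subspace is zero or everything. -/
theorem Representation.isIrreducible_of_finrank_eq_one {G V : Type*} [Group G] [Finite G]
    [AddCommGroup V] [Module ℂ V] [FiniteDimensional ℂ V] (ρ : Representation ℂ G V)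
    (h : Module.finrank ℂ (IntertwiningMap ρ ρ) = 1) : ρ.IsIrreducible := by
  have hV : ∃ v : V, v ≠ 0 := by
    by_contra! hV
    obtain ⟨f, hf⟩ := (Module.finrank_pos_iff_exists_ne_zero (R := ℂ)
      (M := IntertwiningMap ρ ρ)).mp (by omega)
    exact hf (IntertwiningMap.ext (LinearMap.ext fun v => hV _))
  obtain ⟨v₀, hv₀⟩ := hV
  have hid : (IntertwiningMap.id ρ) ≠ 0 := fun h0 => hv₀ (by
    simpa using DFunLike.congr_fun h0 v₀)
  have hsc := (finrank_eq_one_iff_of_nonzero' _ hid).mp h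
  have hnt : (⊥ : Subrepresentation ρ) ≠ ⊤ := fun h0 => hv₀ (by
    have : v₀ ∈ (⊤ : Subrepresentation ρ).toSubmodule := Submodule.mem_top
    rw [← h0] at this
    exact (Submodule.mem_bot ℂ).mp this)
  have : NeZero (Nat.card G : ℂ) := ⟨by exact_mod_cast Nat.card_pos.ne'⟩
  refine { exists_pair_ne := ⟨_, _, hnt⟩, eq_bot_or_eq_top := fun W => ?_ }
  obtain ⟨W', hW⟩ := exists_isCompl W
  have hc : IsCompl W.toSubmodule W'.toSubmodule := by
    refine ⟨disjoint_iff.mpr ?_, codisjoint_iff.mpr ?_⟩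
    · exact congrArg Subrepresentation.toSubmodule hW.inf_eq_bot
    · exact congrArg Subrepresentation.toSubmodule hW.sup_eq_top
  let P := Submodule.projection _ _ hc
  have hP : ∀ (g : G) (v : V), P (ρ g v) = ρ g (P v) := by
    intro g v
    obtain ⟨w, w', rfl⟩ : ∃ (w : W.toSubmodule) (w' : W'.toSubmodule), v = w + w' := by
      obtain ⟨w, hw, w', hw', e⟩ := Submodule.mem_sup.mp
        (hc.sup_eq_top ▸ Submodule.mem_top : v ∈ W.toSubmodule ⊔ W'.toSubmodule)
      exact ⟨⟨w, hw⟩, ⟨w', hw'⟩, e.symm⟩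
    have h1 : P (ρ g w) = ρ g w :=
      Submodule.projection_apply_left hc ⟨_, W.apply_mem_toSubmodule g w.2⟩
    have h2 : P (ρ g w') = 0 :=
      (Submodule.projection_apply_eq_zero_iff hc).mpr (W'.apply_mem_toSubmodule g w'.2)
    have h3 : P w = w := Submodule.projection_apply_left hc w
    have h4 : P w' = 0 := (Submodule.projection_apply_eq_zero_iff hc).mpr w'.2
    simp only [map_add, h1, h2, h3, h4, map_zero]
  obtain ⟨c, hcid⟩ := hsc (LinearMap.intertwiningMap_of_isIntertwiningMap ρ ρ P hP)
  have hcP : ∀ v, c • v = P v := fun v => by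
    simpa using DFunLike.congr_fun hcid v
  by_cases hb : ∃ w ∈ W.toSubmodule, w ≠ 0
  · right
    obtain ⟨w, hw, hw0⟩ := hb
    have h3 : P w = w := Submodule.projection_apply_left hc ⟨w, hw⟩
    have hc1 : c = 1 := by
      have : (c - 1) • w = 0 := by rw [sub_smul, hcP, h3, one_smul, sub_self]
      rcases smul_eq_zero.mp this with h | h
      · exact sub_eq_zero.mp h
      · exact absurd h hw0
    apply Subrepresentation.toSubmodule_injective
    refine top_unique fun v _ => ?_
    have : P v = v := by rw [← hcP, hc1, one_smul]
    rw [← this]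
    exact Submodule.projection_apply_mem hc v
  · left
    push Not at hb
    apply Subrepresentation.toSubmodule_injective
    exact (Submodule.eq_bot_iff _).mpr hb

/-- The character of an irreducible representation on any finite-dimensional space is in `Irr`. -/
theorem character_mem_Irr {G V : Type*} [Group G] [AddCommGroup V] [Module ℂ V]
    [FiniteDimensional ℂ V] (ρ : Representation ℂ G V) (h : ρ.IsIrreducible) :
    ρ.character ∈ Irr G := by
  let e : V ≃ₗ[ℂ] (Fin (Module.finrank ℂ V) → ℂ) := (Module.finBasis ℂ V).equivFun
  let σ : Representation ℂ G (Fin (Module.finrank ℂ V) → ℂ) :=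
    { toFun := fun g => e.conj (ρ g)
      map_one' := by rw [map_one]; exact e.conj_id
      map_mul' := fun x y => by rw [map_mul]; exact e.conj_comp _ _ }
  have he : ∀ g v, e (ρ g v) = σ g (e v) := fun g v => by
    change _ = e (ρ g (e.symm (e v)))
    rw [e.symm_apply_apply]
  refine ⟨_, σ, ?_, ?_⟩
  · let F : Subrepresentation ρ ≃o Subrepresentation σ :=
      { toFun := fun W => ⟨W.toSubmodule.map e.toLinearMap, by
          rintro g _ ⟨v, hv, rfl⟩
          exact ⟨ρ g v, W.apply_mem_toSubmodule g hv, he g v⟩⟩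
        invFun := fun W => ⟨W.toSubmodule.comap e.toLinearMap, by
          intro g v hv
          change e (ρ g v) ∈ W.toSubmodule
          rw [he]
          exact W.apply_mem_toSubmodule g hv⟩
        left_inv := fun W => Subrepresentation.toSubmodule_injective
          (Submodule.comap_map_eq_of_injective e.injective _)
        right_inv := fun W => Subrepresentation.toSubmodule_injective
          (Submodule.map_comap_eq_of_surjective e.surjective _)
        map_rel_iff' := fun {W W'} =>
          Submodule.map_le_map_iff_of_injective (f := e.toLinearMap) e.injective _ _ }
    exact F.isSimpleOrder_iff.mp h
  · ext g
    exact (LinearMap.trace_conj' (ρ g) e).symm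

/-- A linear character of a subgroup, extended by zero to the whole group. -/
structure LinearDatum (G : Type*) [Group G] where
  K : Subgroup G
  μ : G → ℂ
  map_one : μ 1 = 1
  map_mul : ∀ x ∈ K, ∀ y ∈ K, μ (x * y) = μ x * μ y
  map_zero : ∀ x ∉ K, μ x = 0
  map_star : ∀ x ∈ K, star (μ x) = μ x⁻¹

/-! ### Induction of a linear character: the module, its trace, Mackey's formula -/

namespace LinearDatum

variable {G : Type*} [Group G] (D : LinearDatum G)

/-- Extension by zero keeps multiplicativity as long as one factor lies in `K`, since both sides
vanish otherwise. Sums over the whole group can thus be shifted by elements of `K`. -/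
theorem map_mul_left {x : G} (hx : x ∈ D.K) (y : G) : D.μ (x * y) = D.μ x * D.μ y := by
  by_cases hy : y ∈ D.K
  · exact D.map_mul x hx y hy
  · rw [D.map_zero y hy, mul_zero, D.map_zero]
    rwa [D.K.mul_mem_cancel_left hx]

theorem map_mul_right (x : G) {y : G} (hy : y ∈ D.K) : D.μ (x * y) = D.μ x * D.μ y := by
  by_cases hx : x ∈ D.K
  · exact D.map_mul x hx y hy
  · rw [D.map_zero x hx, zero_mul, D.map_zero]
    rwa [D.K.mul_mem_cancel_right hy]

theorem map_mul_inv {x : G} (hx : x ∈ D.K) : D.μ x * D.μ x⁻¹ = 1 := by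
  rw [← D.map_mul_left hx, mul_inv_cancel, D.map_one]

theorem star_μ (x : G) : star (D.μ x) = D.μ x⁻¹ := by
  by_cases hx : x ∈ D.K
  · exact D.map_star x hx
  · rw [D.map_zero x hx, D.map_zero x⁻¹ (by simpa using hx), star_zero]

variable [Fintype G]

/-- The induced character. -/
noncomputable def indChar (g : G) : ℂ := (Nat.card D.K : ℂ)⁻¹ * ∑ x : G, D.μ (x⁻¹ * g * x)

theorem card_ne_zero : (Nat.card D.K : ℂ) ≠ 0 := by exact_mod_cast Nat.card_pos.ne'

theorem sum_eq_card_mul {f : G → ℂ} {c : ℂ} (h0 : ∀ x ∉ D.K, f x = 0) (h1 : ∀ x ∈ D.K, f x = c) :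
    ∑ x, f x = Nat.card D.K * c := by
  classical
  have : ∀ x, f x = if x ∈ D.K then c else 0 := fun x => by
    split_ifs with h
    exacts [h1 x h, h0 x h]
  simp only [this, ← Finset.sum_filter, Finset.sum_const, nsmul_eq_mul]
  rw [← Fintype.card_subtype, Fintype.card_eq_nat_card]

theorem star_indChar (g : G) : star (D.indChar g) = D.indChar g⁻¹ := by
  simp only [indChar, star_mul', star_sum, star_inv₀, star_natCast, star_μ, mul_inv_rev, inv_inv,
    mul_assoc]

theorem indChar_central {z : G} (hc : ∀ g, z * g = g * z) :
    D.indChar z = (Nat.card G : ℂ) / Nat.card D.K * D.μ z := by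
  have : ∀ x : G, D.μ (x⁻¹ * z * x) = D.μ z := fun x => by rw [mul_assoc, hc]; simp
  rw [indChar]
  simp only [this, Finset.sum_const, nsmul_eq_mul, Finset.card_univ, Fintype.card_eq_nat_card]
  ring

theorem indChar_one : D.indChar 1 = (Nat.card G : ℂ) / Nat.card D.K := by
  rw [D.indChar_central (by simp), D.map_one, mul_one]

/-- The space of the induced representation. -/
def indSpace : Submodule ℂ (G → ℂ) where
  carrier := {f | ∀ x, ∀ k ∈ D.K, D.μ k * f (x * k) = f x}
  add_mem' := fun {f f'} hf hf' x k hk => by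
    simp only [Pi.add_apply, mul_add, hf x k hk, hf' x k hk]
  zero_mem' := fun x k _ => by simp
  smul_mem' := fun c f hf x k hk => by
    simp only [Pi.smul_apply, smul_eq_mul, mul_left_comm _ c, hf x k hk]

/-- Left translation of functions. -/
def translate (g : G) : (G → ℂ) →ₗ[ℂ] (G → ℂ) where
  toFun f x := f (g⁻¹ * x)
  map_add' _ _ := rfl
  map_smul' _ _ := rfl

/-- The induced representation. -/
def indRep : Representation ℂ G D.indSpace where
  toFun g := (translate g).restrict (p := D.indSpace) (q := D.indSpace) fun f hf x k hk => by
    change D.μ k * f (g⁻¹ * (x * k)) = f (g⁻¹ * x)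
    rw [← mul_assoc, hf _ k hk]
  map_one' := by ext f x; simp [translate]
  map_mul' g h := by ext f x; simp [translate, mul_assoc]

/-- The projection onto the space of the induced representation. -/
noncomputable def indProj : (G → ℂ) →ₗ[ℂ] (G → ℂ) where
  toFun f x := (Nat.card D.K : ℂ)⁻¹ * ∑ y, D.μ y * f (x * y)
  map_add' f f' := by
    ext x; simp only [Pi.add_apply, mul_add, Finset.sum_add_distrib]
  map_smul' c f := by
    ext x
    simp only [Pi.smul_apply, smul_eq_mul, mul_left_comm _ c, ← Finset.mul_sum, RingHom.id_apply]

theorem indProj_mem (f : G → ℂ) : D.indProj f ∈ D.indSpace := by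
  intro x k hk
  change D.μ k * ((Nat.card D.K : ℂ)⁻¹ * ∑ y, D.μ y * f (x * k * y)) =
    (Nat.card D.K : ℂ)⁻¹ * ∑ y, D.μ y * f (x * y)
  rw [mul_left_comm, Finset.mul_sum]
  congr 1
  refine Fintype.sum_equiv (Equiv.mulLeft k) _ _ fun y => ?_
  rw [Equiv.coe_mulLeft, D.map_mul_left hk]
  simp only [mul_assoc]

theorem indProj_apply {f : G → ℂ} (hf : f ∈ D.indSpace) : D.indProj f = f := by
  ext x
  change (Nat.card D.K : ℂ)⁻¹ * ∑ y, D.μ y * f (x * y) = f x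
  rw [D.sum_eq_card_mul (fun y hy => by rw [D.map_zero y hy, zero_mul]) fun y hy => hf x y hy,
    inv_mul_cancel_left₀ D.card_ne_zero]

/-- Since `indProj` is a projection onto the induced module, the trace on the module is the trace of
translation composed with `indProj` on all functions, which can be read off in the basis of point
masses. -/
theorem character_indRep : D.indRep.character = D.indChar := by
  classical
  ext g
  let π : (G → ℂ) →ₗ[ℂ] D.indSpace := D.indProj.codRestrict _ D.indProj_mem
  have h1 : D.indRep g = π ∘ₗ (translate g ∘ₗ D.indSpace.subtype) := by
    ext f : 1
    apply Subtype.ext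
    exact (D.indProj_apply (D.indRep g f).2).symm
  have h2 : (translate g ∘ₗ D.indSpace.subtype) ∘ₗ π = translate g ∘ₗ D.indProj := rfl
  rw [character, h1, LinearMap.trace_comp_comm', h2, LinearMap.trace_eq_matrix_trace ℂ
    (Pi.basisFun ℂ G), Matrix.trace, indChar, Finset.mul_sum]
  refine Finset.sum_congr rfl fun x _ => ?_
  rw [Matrix.diag_apply, LinearMap.toMatrix_apply, Pi.basisFun_repr, Pi.basisFun_apply]
  change (Nat.card D.K : ℂ)⁻¹ * ∑ y, D.μ y * (Pi.single x 1 : G → ℂ) (g⁻¹ * x * y) = _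
  -- In the diagonal entry at `x`, the point mass is hit only if g⁻¹ x y = x.
  rw [Finset.sum_eq_single (x⁻¹ * g * x)]
  · simp [mul_assoc]
  · intro y _ hy
    rw [Pi.single_eq_of_ne, mul_zero]
    intro h
    apply hy
    rw [mul_assoc, inv_mul_eq_iff_eq_mul] at h
    rw [mul_assoc, ← h, inv_mul_cancel_left]
  · simp

/-- The scalar product of two class functions. -/
noncomputable def _root_.charProd (χ χ' : G → ℂ) : ℂ :=
  (Nat.card G : ℂ)⁻¹ * ∑ g, χ g * χ' g⁻¹

/-- Mackey's formula. -/
theorem charProd_indChar (D' : LinearDatum G) : charProd D.indChar D'.indChar =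
    (Nat.card D.K : ℂ)⁻¹ * (Nat.card D'.K : ℂ)⁻¹ *
      ∑ z : G, ∑ k : G, D.μ k * D'.μ (z⁻¹ * k⁻¹ * z) := by
  have hG : (Nat.card G : ℂ) ≠ 0 := by exact_mod_cast Nat.card_pos.ne'
  have h1 : ∑ g, D.indChar g * D'.indChar g⁻¹ = (Nat.card D.K : ℂ)⁻¹ * (Nat.card D'.K : ℂ)⁻¹ *
      ∑ x : G, ∑ y : G, ∑ g : G, D.μ (x⁻¹ * g * x) * D'.μ (y⁻¹ * g⁻¹ * y) := by
    have : ∀ g, D.indChar g * D'.indChar g⁻¹ = (Nat.card D.K : ℂ)⁻¹ * (Nat.card D'.K : ℂ)⁻¹ *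
        ∑ x : G, ∑ y : G, D.μ (x⁻¹ * g * x) * D'.μ (y⁻¹ * g⁻¹ * y) := fun g => by
      rw [indChar, indChar, mul_mul_mul_comm, Finset.sum_mul_sum]
    rw [Finset.sum_congr rfl fun g _ => this g, ← Finset.mul_sum, Finset.sum_comm]
    congr 1
    refine Finset.sum_congr rfl fun x _ => ?_
    rw [Finset.sum_comm]
  -- The substitution y = x z, g = x k x⁻¹ removes the dependence on `x`, so that the sum over `x`
  -- contributes only the factor |G|.
  have h2 : ∀ x : G, ∑ y : G, ∑ g : G, D.μ (x⁻¹ * g * x) * D'.μ (y⁻¹ * g⁻¹ * y) =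
      ∑ z : G, ∑ k : G, D.μ k * D'.μ (z⁻¹ * k⁻¹ * z) := fun x => by
    refine (Fintype.sum_equiv (Equiv.mulLeft x) _ _ fun z => ?_).symm
    refine Fintype.sum_equiv (MulAut.conj x).toEquiv _ _ fun k => ?_
    simp [mul_assoc]
  rw [charProd, h1]
  simp only [h2, Finset.sum_const, Finset.card_univ, nsmul_eq_mul, Fintype.card_eq_nat_card]
  field_simp

/-- Translating the summation variable by the given `k` multiplies the sum by a constant different
from 1. -/
theorem sum_eq_zero_of_ne (D' : LinearDatum G) (z : G)
    (h : ∃ k ∈ D.K, z⁻¹ * k * z ∈ D'.K ∧ D.μ k ≠ D'.μ (z⁻¹ * k * z)) :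
    ∑ k : G, D.μ k * D'.μ (z⁻¹ * k⁻¹ * z) = 0 := by
  obtain ⟨k₀, h1, h2, h3⟩ := h
  have hinv : (z⁻¹ * k₀ * z)⁻¹ = z⁻¹ * k₀⁻¹ * z := by simp [mul_assoc]
  have hs : ∑ k : G, D.μ k * D'.μ (z⁻¹ * k⁻¹ * z) =
      (D.μ k₀ * D'.μ (z⁻¹ * k₀⁻¹ * z)) * ∑ k : G, D.μ k * D'.μ (z⁻¹ * k⁻¹ * z) := by
    rw [Finset.mul_sum]
    refine (Fintype.sum_equiv (Equiv.mulLeft k₀) _ _ fun k => ?_).symm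
    have h4 : z⁻¹ * (k₀ * k)⁻¹ * z = (z⁻¹ * k⁻¹ * z) * (z⁻¹ * k₀⁻¹ * z) := by simp [mul_assoc]
    rw [Equiv.coe_mulLeft, h4, D.map_mul_left h1,
      D'.map_mul_right (z⁻¹ * k⁻¹ * z) (hinv ▸ D'.K.inv_mem h2)]
    ring
  have h5 : D.μ k₀ * D'.μ (z⁻¹ * k₀⁻¹ * z) ≠ 1 := by
    intro h5
    apply h3
    have h6 := D'.map_mul_inv h2
    rw [hinv] at h6
    have h7 : D'.μ (z⁻¹ * k₀⁻¹ * z) ≠ 0 := fun h0 => by simp [h0] at h5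
    exact mul_right_cancel₀ h7 (h5.trans h6.symm)
  have : (1 - D.μ k₀ * D'.μ (z⁻¹ * k₀⁻¹ * z)) * ∑ k : G, D.μ k * D'.μ (z⁻¹ * k⁻¹ * z) = 0 := by
    rw [sub_mul, one_mul, sub_eq_zero]; exact hs
  rcases mul_eq_zero.mp this with h | h
  · exact absurd (sub_eq_zero.mp h).symm h5
  · exact h

theorem charProd_indChar_eq_zero (D' : LinearDatum G)
    (h : ∀ z : G, ∃ k ∈ D.K, z⁻¹ * k * z ∈ D'.K ∧ D.μ k ≠ D'.μ (z⁻¹ * k * z)) :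
    charProd D.indChar D'.indChar = 0 := by
  rw [charProd_indChar, Finset.sum_eq_zero fun z _ => sum_eq_zero_of_ne D D' z (h z), mul_zero]

/-- In Mackey's formula only z ∈ `K` survive, and each contributes |K| because a linear character is
invariant under conjugation by its own group. -/
theorem charProd_indChar_self
    (h : ∀ z ∉ D.K, ∃ k ∈ D.K, z⁻¹ * k * z ∈ D.K ∧ D.μ k ≠ D.μ (z⁻¹ * k * z)) :
    charProd D.indChar D.indChar = 1 := by
  have hin : ∀ z ∈ D.K, ∑ k : G, D.μ k * D.μ (z⁻¹ * k⁻¹ * z) = Nat.card D.K := by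
    intro z hz
    rw [D.sum_eq_card_mul (c := 1) (fun y hy => by rw [D.map_zero y hy, zero_mul]) fun k hk => ?_,
      mul_one]
    rw [D.map_mul_right _ hz, D.map_mul_left (D.K.inv_mem hz)]
    linear_combination D.map_mul_inv hk + D.μ k * D.μ k⁻¹ * D.map_mul_inv hz
  rw [charProd_indChar, D.sum_eq_card_mul (fun z hz => sum_eq_zero_of_ne D D z (h z hz)) hin]
  have := D.card_ne_zero
  field_simp

/-- The norm of a character is the dimension of its endomorphism algebra, so norm 1 means
irreducible. -/
theorem indChar_mem_Irr
    (h : ∀ z ∉ D.K, ∃ k ∈ D.K, z⁻¹ * k * z ∈ D.K ∧ D.μ k ≠ D.μ (z⁻¹ * k * z)) :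
    D.indChar ∈ Irr G := by
  rw [← character_indRep]
  apply character_mem_Irr
  apply Representation.isIrreducible_of_finrank_eq_one
  have hG : (Nat.card G : ℂ) ≠ 0 := by exact_mod_cast Nat.card_pos.ne'
  let := invertibleOfNonzero hG
  have h1 := card_inv_mul_sum_char_mul_char_eq_finrank D.indRep D.indRep
  rw [character_indRep] at h1
  have h2 := D.charProd_indChar_self h
  rw [charProd, h1] at h2
  exact_mod_cast h2

end LinearDatum

/-! ### Orthogonality, central characters and completeness -/

theorem charProd_eq_zero_of_ne {G : Type*} [Group G] [Fintype G] {χ χ' : G → ℂ}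
    (h : χ ∈ Irr G) (h' : χ' ∈ Irr G) (hne : χ ≠ χ') : charProd χ χ' = 0 := by
  obtain ⟨n, ρ, hρ, rfl⟩ := h
  obtain ⟨m, σ, hσ, rfl⟩ := h'
  have hG : (Nat.card G : ℂ) ≠ 0 := by exact_mod_cast Nat.card_pos.ne'
  let := invertibleOfNonzero hG
  rw [charProd, char_orthonormal ρ σ, if_neg]
  rintro ⟨e⟩
  exact hne (char_iso e).symm

/-- A central element multiplies an irreducible character by a scalar. -/
theorem exists_centralChar {G : Type*} [Group G] [Fintype G] {χ : G → ℂ} (h : χ ∈ Irr G) :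
    χ 1 ≠ 0 ∧ ∃ c : Subgroup.center G →* ℂ, ∀ z : Subgroup.center G, ∀ g,
      χ (z * g) = c z * χ g := by
  obtain ⟨n, ρ, hρ, rfl⟩ := h
  have key : ∀ z : Subgroup.center G, ∃ c : ℂ, ∀ v, ρ z v = c • v := by
    intro z
    obtain ⟨c, hc⟩ := (IsIrreducible.algebraMap_intertwiningMap_bijective_of_isAlgClosed
      (ρ := ρ)).2 (LinearMap.intertwiningMap_of_isIntertwiningMap ρ ρ (ρ z) fun g v => by
        rw [← Module.End.mul_apply, ← Module.End.mul_apply, ← map_mul, ← map_mul,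
          Subgroup.mem_center_iff.mp z.2 g])
    exact ⟨c, fun v => by simpa using (DFunLike.congr_fun hc v).symm⟩
  choose c hc using key
  have hn : ∃ v : Fin n → ℂ, v ≠ 0 := by
    by_contra! hn
    obtain ⟨W, W', hW⟩ := hρ.exists_pair_ne
    apply hW
    apply Subrepresentation.toSubmodule_injective
    ext v
    rw [hn v]
    simp
  obtain ⟨v, hv⟩ := hn
  refine ⟨?_, { toFun := c, map_one' := ?_, map_mul' := fun z w => ?_ }, fun z g => ?_⟩
  · have : Nontrivial (Fin n → ℂ) := ⟨v, 0, hv⟩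
    rw [char_one]
    exact_mod_cast Module.finrank_pos.ne'
  · have := hc 1 v
    rw [Subgroup.coe_one, map_one, Module.End.one_apply] at this
    have h2 : (c 1 - 1) • v = 0 := by rw [sub_smul, ← this, one_smul, sub_self]
    exact sub_eq_zero.mp ((smul_eq_zero.mp h2).resolve_right hv)
  · have := hc (z * w) v
    rw [Subgroup.coe_mul, map_mul, Module.End.mul_apply, hc w, map_smul, hc z, smul_smul] at this
    have h2 : (c (z * w) - c z * c w) • v = 0 := by
      rw [sub_smul, ← this, mul_comm, sub_self]
    exact sub_eq_zero.mp ((smul_eq_zero.mp h2).resolve_right hv)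
  · have : ρ z = c z • LinearMap.id := LinearMap.ext fun v => hc z v
    rw [character, map_mul, this, smul_mul_assoc, map_smul, smul_eq_mul]
    rfl

/-- A set of distinct irreducible induced characters over a linear character `Z.μ` of a central
subgroup `Z.K` is complete if the squares of the degrees add up to the index of `Z.K`. -/
theorem exists_eq_indChar {G : Type*} [Group G] [Fintype G] {L : Type*} [Fintype L]
    (Z : LinearDatum G) (hZ : ∀ z ∈ Z.K, ∀ g, z * g = g * z) (D : L → LinearDatum G)
    (hirr : ∀ ℓ, (D ℓ).indChar ∈ Irr G)
    (hself : ∀ ℓ, charProd (D ℓ).indChar (D ℓ).indChar = 1)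
    (hinj : Function.Injective fun ℓ => (D ℓ).indChar)
    (hover : ∀ ℓ, ∀ z ∈ Z.K, z ∈ (D ℓ).K ∧ (D ℓ).μ z = Z.μ z)
    (hsum : ∑ ℓ, (D ℓ).indChar 1 * (D ℓ).indChar 1 = (Nat.card G : ℂ) / Nat.card Z.K)
    {χ : G → ℂ} (hχ : χ ∈ Irr G) (hχZ : ∀ z ∈ Z.K, χ z = Z.μ z * χ 1) :
    ∃ ℓ, χ = (D ℓ).indChar := by
  classical
  by_contra! hne
  have hG : (Nat.card G : ℂ) ≠ 0 := by exact_mod_cast Nat.card_pos.ne'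
  have hf0 : ∀ g ∉ Z.K, Z.indChar g = 0 := fun g hg => by
    rw [LinearDatum.indChar, Finset.sum_eq_zero, mul_zero]
    intro x _
    apply Z.map_zero
    intro h
    apply hg
    have := hZ _ h x
    have h2 : g = x * (x⁻¹ * g * x) * x⁻¹ := by simp [mul_assoc]
    rw [h2, ← this]
    simpa using h
  -- Frobenius reciprocity: the character induced from the central subgroup contains each character
  -- lying over `Z.μ` with multiplicity its degree.
  have hfχ : ∀ ξ : G → ℂ, (∀ z ∈ Z.K, ξ z = Z.μ z * ξ 1) → charProd ξ Z.indChar = ξ 1 := by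
    intro ξ hξ
    rw [charProd, Z.sum_eq_card_mul (c := ξ 1 * ((Nat.card G : ℂ) / Nat.card Z.K))
      (fun g hg => by rw [hf0 g⁻¹ (by simpa using hg), mul_zero]) fun z hz => ?_]
    · have := Z.card_ne_zero
      field_simp
    · rw [Z.indChar_central (hZ _ (Z.K.inv_mem hz)), hξ z hz]
      linear_combination (ξ 1 * ((Nat.card G : ℂ) / Nat.card Z.K)) * Z.map_mul_inv hz
  have hfd : ∀ ℓ, charProd (D ℓ).indChar Z.indChar = (D ℓ).indChar 1 :=
    fun ℓ => hfχ _ fun z hz => by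
    rw [(D ℓ).indChar_central (hZ z hz), (D ℓ).indChar_one, (hover ℓ z hz).2,
      mul_comm]
  have hff : charProd Z.indChar Z.indChar = Z.indChar 1 := hfχ _ fun z hz => by
    rw [Z.indChar_central (hZ z hz), Z.indChar_one, mul_comm]
  have hadd : ∀ a b c : G → ℂ, charProd (a - b) c = charProd a c - charProd b c := fun a b c => by
    simp only [charProd, Pi.sub_apply, sub_mul, Finset.sum_sub_distrib, mul_sub]
  have hsm : ∀ (d : L → ℂ) (a : L → G → ℂ) (c : G → ℂ),
      charProd (∑ ℓ, d ℓ • a ℓ) c = ∑ ℓ, d ℓ * charProd (a ℓ) c := fun d a c => by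
    simp only [charProd, Finset.sum_apply, Pi.smul_apply, smul_eq_mul, Finset.sum_mul]
    rw [Finset.sum_comm, Finset.mul_sum]
    refine Finset.sum_congr rfl fun ℓ _ => ?_
    simp only [mul_assoc, ← Finset.mul_sum]
    ring
  have hsymm : ∀ a b : G → ℂ, charProd a b = charProd b a := fun a b => by
    rw [charProd, charProd]
    congr 1
    refine Fintype.sum_equiv (Equiv.inv G) _ _ fun g => ?_
    simp [mul_comm]
  -- The part of the character induced from `Z` that is accounted for by the given family. By `hsum`
  -- it has the same norm as the whole, so the difference has norm 0.
  set s : G → ℂ := ∑ ℓ, (D ℓ).indChar 1 • (D ℓ).indChar with hs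
  have hsd : ∀ ℓ, charProd s (D ℓ).indChar = (D ℓ).indChar 1 := fun ℓ => by
    rw [hs, hsm, Finset.sum_eq_single ℓ]
    · rw [hself, mul_one]
    · intro m _ hm
      rw [charProd_eq_zero_of_ne (hirr m) (hirr ℓ) fun h => hm (hinj h), mul_zero]
    · simp
  have hss : charProd s s = Z.indChar 1 := by
    have : charProd s s = ∑ ℓ, (D ℓ).indChar 1 * charProd (D ℓ).indChar s := by
      conv_lhs => rw [hs]
      rw [hsm]
    rw [this, Z.indChar_one, ← hsum]
    exact Finset.sum_congr rfl fun ℓ _ => by rw [hsymm, hsd]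
  have hsZ : charProd s Z.indChar = Z.indChar 1 := by
    rw [hs, hsm, Z.indChar_one, ← hsum]
    exact Finset.sum_congr rfl fun ℓ _ => by rw [hfd]
  have hh : charProd (Z.indChar - s) (Z.indChar - s) = 0 := by
    rw [hadd, hsymm _ (Z.indChar - s), hsymm s, hadd, hadd, hff, hsZ, hsymm, hsZ, hss]
    ring
  -- This makes the bilinear product positive definite on the difference, so norm 0 forces it to
  -- vanish. The degrees, being values at 1, are real by `star_indChar`.
  have hstar : ∀ g, (Z.indChar - s) g⁻¹ = star ((Z.indChar - s) g) := fun g => by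
    simp only [hs, Pi.sub_apply, Finset.sum_apply, Pi.smul_apply, smul_eq_mul, star_sub, star_sum,
      star_mul', LinearDatum.star_indChar, inv_one]
  have hzero : Z.indChar - s = 0 := by
    have h1 : ∑ g, (Z.indChar - s) g * (Z.indChar - s) g⁻¹ = 0 :=
      (mul_eq_zero.mp hh).resolve_left (inv_ne_zero hG)
    have h2 : ∑ g, ‖(Z.indChar - s) g‖ ^ 2 = 0 := by
      have : ∀ g, (Z.indChar - s) g * (Z.indChar - s) g⁻¹ =
          ((‖(Z.indChar - s) g‖ ^ 2 : ℝ) : ℂ) := fun g => by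
        rw [hstar]
        push_cast
        exact Complex.mul_conj' _
      simp only [this] at h1
      exact_mod_cast h1
    ext g
    have := (Finset.sum_eq_zero_iff_of_nonneg fun g _ => sq_nonneg _).mp h2 g (Finset.mem_univ g)
    simpa using this
  -- A missing character would be orthogonal to `s`, which is the induced character, although it
  -- occurs there with multiplicity χ(1) ≠ 0.
  have h3 : charProd χ Z.indChar = χ 1 := hfχ χ hχZ
  have h4 : charProd s χ = 0 := by
    rw [hs, hsm]
    exact Finset.sum_eq_zero fun ℓ _ => by
      rw [charProd_eq_zero_of_ne (hirr ℓ) hχ (Ne.symm (hne ℓ)), mul_zero]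
  rw [sub_eq_zero.mp hzero, hsymm, h4] at h3
  exact (exists_centralChar hχ).1 h3.symm

end RepresentationTheory

/-! ### Coordinates on the quattern group -/

/-- Coordinates on the quattern group `X_S` of type `D₆`: `g` and `k` are the entries of two upper
unitriangular `3 × 3` matrices, `m` those of a `3 × 3` matrix, `p` those of an alternating
`3 × 3` matrix and `s` those of a `3 × 3` matrix modulo strictly upper triangular matrices. -/
@[ext]
structure CoreGroup (F : Type*) where
  g01 : F
  g12 : F
  g02 : F
  k01 : F
  k12 : F
  k02 : F
  m00 : F
  m01 : F
  m02 : F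
  m10 : F
  m11 : F
  m12 : F
  m20 : F
  m21 : F
  m22 : F
  p01 : F
  p02 : F
  p12 : F
  s00 : F
  s10 : F
  s11 : F
  s20 : F
  s21 : F
  s22 : F

namespace CoreGroup

variable {F : Type*} [Field F]

instance : One (CoreGroup F) :=
  ⟨⟨0, 0, 0, 0, 0, 0, 0, 0, 0, 0, 0, 0, 0, 0, 0, 0, 0, 0, 0, 0, 0, 0, 0, 0⟩⟩

/-- In terms of matrices, `(s, p, m, g, k) * (s', p', m', g', k')` is
`(s + g s' k⁻¹ + m t, p + t, m + g m' kᵀ, g g', k k')`, where `t = k⁻ᵀ p' k⁻¹`. -/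
def mul (e f : CoreGroup F) : CoreGroup F :=
  { g01 := e.g01 + f.g01
    g12 := e.g12 + f.g12
    g02 := e.g02 + f.g02 + e.g01 * f.g12
    k01 := e.k01 + f.k01
    k12 := e.k12 + f.k12
    k02 := e.k02 + f.k02 + e.k01 * f.k12
    m00 := e.m00 + (f.m00 + e.g01 * f.m10 + e.g02 * f.m20)
      + (f.m01 + e.g01 * f.m11 + e.g02 * f.m21) * e.k01
      + (f.m02 + e.g01 * f.m12 + e.g02 * f.m22) * e.k02
    m01 := e.m01 + (f.m01 + e.g01 * f.m11 + e.g02 * f.m21)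
      + (f.m02 + e.g01 * f.m12 + e.g02 * f.m22) * e.k12
    m02 := e.m02 + (f.m02 + e.g01 * f.m12 + e.g02 * f.m22)
    m10 := e.m10 + (f.m10 + e.g12 * f.m20) + (f.m11 + e.g12 * f.m21) * e.k01
      + (f.m12 + e.g12 * f.m22) * e.k02
    m11 := e.m11 + (f.m11 + e.g12 * f.m21) + (f.m12 + e.g12 * f.m22) * e.k12
    m12 := e.m12 + (f.m12 + e.g12 * f.m22)
    m20 := e.m20 + f.m20 + f.m21 * e.k01 + f.m22 * e.k02
    m21 := e.m21 + f.m21 + f.m22 * e.k12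
    m22 := e.m22 + f.m22
    p01 := e.p01 + f.p01
    p02 := e.p02 + (f.p02 - e.k12 * f.p01)
    p12 := e.p12 + (f.p12 - e.k01 * f.p02 + e.k02 * f.p01)
    s00 := e.s00 + (f.s00 + e.g01 * f.s10 + e.g02 * f.s20)
      - e.m01 * f.p01 - e.m02 * (f.p02 - e.k12 * f.p01)
    s10 := e.s10 + (f.s10 + e.g12 * f.s20)
      - e.m11 * f.p01 - e.m12 * (f.p02 - e.k12 * f.p01)
    s11 := e.s11 + (f.s11 + e.g12 * f.s21) - e.k01 * (f.s10 + e.g12 * f.s20)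
      + e.m10 * f.p01 - e.m12 * (f.p12 - e.k01 * f.p02 + e.k02 * f.p01)
    s20 := e.s20 + f.s20 - e.m21 * f.p01 - e.m22 * (f.p02 - e.k12 * f.p01)
    s21 := e.s21 + f.s21 - e.k01 * f.s20
      + e.m20 * f.p01 - e.m22 * (f.p12 - e.k01 * f.p02 + e.k02 * f.p01)
    s22 := e.s22 + f.s22 - e.k12 * f.s21 + (e.k01 * e.k12 - e.k02) * f.s20
      + e.m20 * (f.p02 - e.k12 * f.p01)
      + e.m21 * (f.p12 - e.k01 * f.p02 + e.k02 * f.p01) }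

instance : Mul (CoreGroup F) := ⟨mul⟩

theorem mul_def (e f : CoreGroup F) : e * f = mul e f := rfl

theorem one_def : (1 : CoreGroup F) =
    ⟨0, 0, 0, 0, 0, 0, 0, 0, 0, 0, 0, 0, 0, 0, 0, 0, 0, 0, 0, 0, 0, 0, 0, 0⟩ := rfl

/-- Three stages: `a` inverts the unitriangular parts, `b` then cancels `m`, and the last step
cancels `p` and `s`. Each correction is a simple negation because these coordinates of the left
factor enter their own coordinates of a product additively. -/
instance : Inv (CoreGroup F) := ⟨fun e =>
  let a : CoreGroup F := { (1 : CoreGroup F) with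
    g01 := -e.g01
    g12 := -e.g12
    g02 := e.g01 * e.g12 - e.g02
    k01 := -e.k01
    k12 := -e.k12
    k02 := e.k01 * e.k12 - e.k02 }
  let b : CoreGroup F := { a with
    m00 := -(a * e).m00
    m01 := -(a * e).m01
    m02 := -(a * e).m02
    m10 := -(a * e).m10
    m11 := -(a * e).m11
    m12 := -(a * e).m12
    m20 := -(a * e).m20
    m21 := -(a * e).m21
    m22 := -(a * e).m22 }
  { b with
    p01 := -(b * e).p01
    p02 := -(b * e).p02
    p12 := -(b * e).p12
    s00 := -(b * e).s00
    s10 := -(b * e).s10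
    s11 := -(b * e).s11
    s20 := -(b * e).s20
    s21 := -(b * e).s21
    s22 := -(b * e).s22 }⟩

theorem inv_mul (e : CoreGroup F) : e⁻¹ * e = 1 := by
  simp only [Inv.inv]
  ext <;> simp only [mul_def, mul, one_def] <;> ring

instance : Group (CoreGroup F) :=
  Group.ofLeftAxioms
    (fun e f h => by ext <;> simp only [mul_def, mul] <;> ring)
    (fun e => by ext <;> simp only [mul_def, mul, one_def] <;> ring)
    inv_mul

end CoreGroup

/-! ### Ternary quadratic forms and the inducing characters -/

/-- The ternary quadratic form `a x₀² + u x₀ x₁ + v x₀ x₂ + b x₁² + c x₁ x₂ + d x₂²`. -/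
@[ext]
structure TernaryForm (F : Type*) where
  a : F
  u : F
  v : F
  b : F
  c : F
  d : F

namespace TernaryForm

variable {F : Type*} [Field F]

/-- The form `q` after the substitution `x₀ ↦ x₀ + r x₁ + s x₂`, `x₁ ↦ x₁ + t x₂`. -/
def act (q : TernaryForm F) (r s t : F) : TernaryForm F where
  a := q.a
  u := q.u + 2 * q.a * r
  v := q.v + 2 * q.a * s + q.u * t
  b := q.b + q.a * r ^ 2 + q.u * r
  c := q.c + 2 * q.a * r * s + q.u * r * t + q.u * s + q.v * r + 2 * q.b * t
  d := q.d + q.a * s ^ 2 + q.u * s * t + q.v * s + q.b * t ^ 2 + q.c * t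

theorem act_act (q : TernaryForm F) (r s t r' s' t' : F) :
    (q.act r s t).act r' s' t' = q.act (r + r') (s + s' + r * t') (t + t') := by
  ext <;> simp only [act] <;> ring

theorem act_zero (q : TernaryForm F) : q.act 0 0 0 = q := by
  ext <;> simp [act]

/-- The pairing of a quadratic form with (the upper triangle of) a symmetric matrix. -/
def pair (q : TernaryForm F) (e : CoreGroup F) : F :=
  q.a * e.m00 + q.u * e.m01 + q.v * e.m02 + q.b * e.m11 + q.c * e.m12 + q.d * e.m22

end TernaryForm

namespace CoreGroup

variable {F : Type*} [Field F]

/-- Conjugation of the matrix `m` of `f` by a unitriangular matrix. -/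
theorem pair_mul (q : TernaryForm F) (e f : CoreGroup F) (h01 : e.k01 = e.g01)
    (h12 : e.k12 = e.g12) (h02 : e.k02 = e.g02) (f10 : f.m10 = f.m01) (f20 : f.m20 = f.m02)
    (f21 : f.m21 = f.m12) :
    q.pair (e * f) = q.pair e + (q.act e.g01 e.g02 e.g12).pair f := by
  simp only [TernaryForm.pair, TernaryForm.act, mul_def, mul, h01, h12, h02, f10, f20, f21]
  ring

/-- The elements of the group from which the irreducible characters are induced. -/
structure MemStab (q : TernaryForm F) (e : CoreGroup F) : Prop where
  k01 : e.k01 = e.g01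
  k12 : e.k12 = e.g12
  k02 : e.k02 = e.g02
  m10 : e.m10 = e.m01
  m20 : e.m20 = e.m02
  m21 : e.m21 = e.m12
  act : q.act e.g01 e.g02 e.g12 = q

theorem MemStab.one (q : TernaryForm F) : MemStab q 1 :=
  ⟨rfl, rfl, rfl, rfl, rfl, rfl, q.act_zero⟩

theorem MemStab.mul {q : TernaryForm F} {e f : CoreGroup F} (he : MemStab q e)
    (hf : MemStab q f) : MemStab q (e * f) where
  k01 := by simp only [mul_def, CoreGroup.mul, he.k01, hf.k01]
  k12 := by simp only [mul_def, CoreGroup.mul, he.k12, hf.k12]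
  k02 := by simp only [mul_def, CoreGroup.mul, he.k01, he.k02, hf.k02, hf.k12]
  m10 := by
    simp only [mul_def, CoreGroup.mul, he.k01, he.k02, he.k12, he.m10, hf.m10, hf.m20, hf.m21]
    ring
  m20 := by
    simp only [mul_def, CoreGroup.mul, he.k01, he.k02, he.k12, he.m20, hf.m10, hf.m20, hf.m21]
    ring
  m21 := by
    simp only [mul_def, CoreGroup.mul, he.k01, he.k02, he.k12, he.m21, hf.m10, hf.m20, hf.m21]
    ring
  act := by
    have h := q.act_act e.g01 e.g02 e.g12 f.g01 f.g02 f.g12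
    rw [he.act, hf.act] at h
    exact h.symm

/-- An equivalence with the space of coordinates. -/
def equivFin : CoreGroup F ≃ (Fin 24 → F) where
  toFun e := ![e.g01, e.g12, e.g02, e.k01, e.k12, e.k02, e.m00, e.m01, e.m02, e.m10, e.m11, e.m12,
    e.m20, e.m21, e.m22, e.p01, e.p02, e.p12, e.s00, e.s10, e.s11, e.s20, e.s21, e.s22]
  invFun f := ⟨f 0, f 1, f 2, f 3, f 4, f 5, f 6, f 7, f 8, f 9, f 10, f 11, f 12, f 13, f 14, f 15,
    f 16, f 17, f 18, f 19, f 20, f 21, f 22, f 23⟩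
  left_inv _ := rfl
  right_inv f := by ext i; fin_cases i <;> rfl

instance [Finite F] : Finite (CoreGroup F) := Finite.of_equiv _ equivFin.symm

noncomputable instance [Finite F] : Fintype (CoreGroup F) := Fintype.ofFinite _

omit [Field F] in
theorem card_eq [Finite F] : Nat.card (CoreGroup F) = Nat.card F ^ 24 := by
  rw [Nat.card_congr equivFin, Nat.card_fun, Nat.card_eq_fintype_card (α := Fin 24),
    Fintype.card_fin]

/-- A subset of a finite group which is closed under multiplication is a subgroup. -/
def _root_.Subgroup.ofMulClosed {G : Type*} [Group G] [Finite G] (S : Set G) (h1 : 1 ∈ S)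
    (hm : ∀ x ∈ S, ∀ y ∈ S, x * y ∈ S) : Subgroup G where
  carrier := S
  one_mem' := h1
  mul_mem' := fun hx hy => hm _ hx _ hy
  inv_mem' := fun {x} hx => by
    rw [inv_eq_of_mul_eq_one_right (b := x ^ (orderOf x - 1))
      (by rw [← pow_succ', Nat.sub_add_cancel (orderOf_pos x), pow_orderOf_eq_one])]
    have : ∀ n : ℕ, x ^ n ∈ S := fun n => by
      induction n with
      | zero => simpa using h1
      | succ n ih => rw [pow_succ]; exact hm _ ih _ hx
    exact this _

/-- The stabilizer of a quadratic form in the group of unitriangular matrices. -/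
abbrev _root_.TernaryForm.Stab (q : TernaryForm F) : Type _ :=
  {r : F × F × F // q.act r.1 r.2.1 r.2.2 = q}

variable [Finite F]

/-- The group from which the irreducible characters are induced. -/
def stabGroup (q : TernaryForm F) : Subgroup (CoreGroup F) :=
  Subgroup.ofMulClosed {e | MemStab q e} (MemStab.one q) fun _ hx _ hy => hx.mul hy

theorem mem_stabGroup {q : TernaryForm F} {e : CoreGroup F} : e ∈ stabGroup q ↔ MemStab q e :=
  Iff.rfl

/-- Coordinates on `stabGroup q`. -/
def stabEquiv (q : TernaryForm F) : stabGroup q ≃ q.Stab × (Fin 15 → F) where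
  toFun e := (⟨(e.1.g01, e.1.g02, e.1.g12), e.2.act⟩, ![e.1.m00, e.1.m01, e.1.m02, e.1.m11,
    e.1.m12, e.1.m22, e.1.p01, e.1.p02, e.1.p12, e.1.s00, e.1.s10, e.1.s11, e.1.s20, e.1.s21,
    e.1.s22])
  invFun f := ⟨⟨f.1.1.1, f.1.1.2.2, f.1.1.2.1, f.1.1.1, f.1.1.2.2, f.1.1.2.1, f.2 0, f.2 1, f.2 2,
    f.2 1, f.2 3, f.2 4, f.2 2, f.2 4, f.2 5, f.2 6, f.2 7, f.2 8, f.2 9, f.2 10, f.2 11, f.2 12,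
    f.2 13, f.2 14⟩, ⟨rfl, rfl, rfl, rfl, rfl, rfl, f.1.2⟩⟩
  left_inv e := by
    obtain ⟨e, h⟩ := e
    have h := mem_stabGroup.mp h
    apply Subtype.ext
    ext <;> first | rfl | exact h.k01.symm | exact h.k12.symm | exact h.k02.symm |
      exact h.m10.symm | exact h.m20.symm | exact h.m21.symm
  right_inv f := by
    refine Prod.ext rfl ?_
    ext i
    fin_cases i <;> rfl

theorem card_stabGroup (q : TernaryForm F) :
    Nat.card (stabGroup q) = Nat.card q.Stab * Nat.card F ^ 15 := by
  rw [Nat.card_congr (stabEquiv q), Nat.card_prod, Nat.card_fun,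
    Nat.card_eq_fintype_card (α := Fin 15), Fintype.card_fin]

end CoreGroup

/-- A quadratic form together with a linear functional on its stabilizer. -/
structure StabLabel (F : Type*) [Field F] where
  q : TernaryForm F
  e₁ : F
  e₂ : F
  e₃ : F
  -- The coordinate g02 of a product has the cross term g01 g12; this condition makes the functional
  -- (e₁, e₂, e₃) additive on the stabilizer.
  additive : ∀ r s t r' s' t', q.act r s t = q → q.act r' s' t' = q → e₂ * (r * t') = 0

namespace StabLabel

open CoreGroup

variable {F : Type*} [Field F] (Λ : StabLabel F)

/-- The exponent of the linear character with label `Λ`. -/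
def exponent (e : CoreGroup F) : F :=
  e.s00 + e.s11 + e.s22 + Λ.q.pair e + Λ.e₁ * e.g01 + Λ.e₂ * e.g02 + Λ.e₃ * e.g12

theorem exponent_one : Λ.exponent 1 = 0 := by
  simp [exponent, TernaryForm.pair, one_def]

/-- With k = g, the term g s' k⁻¹ has the trace of s'. The term m t contributes nothing, since the
trace of a symmetric times an alternating matrix is 0 in every characteristic. The form is fixed by
g, so `pair` is additive too. -/
theorem exponent_mul {e f : CoreGroup F} (he : MemStab Λ.q e) (hf : MemStab Λ.q f) :
    Λ.exponent (e * f) = Λ.exponent e + Λ.exponent f := by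
  have h1 := Λ.additive _ _ _ _ _ _ he.act hf.act
  have h2 := pair_mul Λ.q e f he.k01 he.k12 he.k02 hf.m10 hf.m20 hf.m21
  rw [he.act] at h2
  simp only [exponent, h2]
  simp only [mul_def, mul, he.k01, he.k12, he.k02, he.m10, he.m20, he.m21]
  linear_combination h1

variable [Finite F] (ψ : AddChar F ℂ)

open Classical in
/-- The linear character with label `Λ`. -/
noncomputable def linearDatum : LinearDatum (CoreGroup F) where
  K := stabGroup Λ.q
  μ e := if MemStab Λ.q e then ψ (Λ.exponent e) else 0
  map_one := by rw [if_pos (MemStab.one _), exponent_one, AddChar.map_zero_eq_one]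
  map_mul x hx y hy := by
    rw [mem_stabGroup] at hx hy
    rw [if_pos hx, if_pos hy, if_pos (hx.mul hy), exponent_mul Λ hx hy, AddChar.map_add_eq_mul]
  map_zero x hx := if_neg hx
  map_star x hx := by
    have hx' := (stabGroup Λ.q).inv_mem hx
    rw [mem_stabGroup] at hx hx'
    have h := exponent_mul Λ hx hx'
    rw [mul_inv_cancel, exponent_one] at h
    rw [if_pos hx, if_pos hx', eq_neg_of_add_eq_zero_right h.symm, AddChar.map_neg_eq_conj]
    rfl

theorem linearDatum_K : (Λ.linearDatum ψ).K = stabGroup Λ.q := rfl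

theorem linearDatum_μ {e : CoreGroup F} (h : MemStab Λ.q e) :
    (Λ.linearDatum ψ).μ e = ψ (Λ.exponent e) := if_pos h

/-! ### Intertwiners of the linear characters -/

variable {ψ}

omit [Finite F] in
theorem _root_.AddChar.eq_zero_of_forall_mul (hψ : ψ ≠ 1) {c : F} (h : ∀ t, ψ (c * t) = 1) :
    c = 0 := by
  by_contra hc
  apply hψ
  ext t
  rw [← mul_inv_cancel_left₀ hc t, h]
  rfl

/-- The device for comparing coefficients: if ψ cannot distinguish two exponents that differ by a
linear term, that term is zero. -/
theorem _root_.AddChar.eq_zero_of_forall_eq (hψ : ψ ≠ 1) {c : F} (x y : F → F)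
    (h : ∀ t, ψ (x t) = ψ (y t)) (hc : ∀ t, x t = c * t + y t) : c = 0 := by
  apply AddChar.eq_zero_of_forall_mul hψ
  intro t
  have h1 := h t
  rw [hc t, AddChar.map_add_eq_mul] at h1
  have h2 : ψ (y t) ≠ 0 := fun h0 => by
    have := AddChar.map_neg_eq_conj ψ (y t)
    have h3 := AddChar.map_add_eq_mul ψ (y t) (-(y t))
    rw [h0, add_neg_cancel, AddChar.map_zero_eq_one, zero_mul] at h3
    exact one_ne_zero h3
  exact mul_right_cancel₀ h2 (h1.trans (one_mul _).symm)

/-- If `z` intertwines the linear characters with labels `Λ` and `Λ'`, then `z` comes from a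
symmetric matrix and a unitriangular matrix which maps one quadratic form to the other. -/
theorem intertwine (hψ : ψ ≠ 1) (Λ Λ' : StabLabel F) (hq : Λ.q.a = Λ'.q.a) (z : CoreGroup F)
    (h : ∀ n n', MemStab Λ.q n → MemStab Λ'.q n' → n * z = z * n' →
      ψ (Λ.exponent n) = ψ (Λ'.exponent n')) :
    (z.k01 = z.g01 ∧ z.k12 = z.g12 ∧ z.k02 = z.g02) ∧
      (z.m10 = z.m01 ∧ z.m20 = z.m02 ∧ z.m21 = z.m12) ∧
      Λ.q.act z.g01 z.g02 z.g12 = Λ'.q := by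
  -- First test on the abelian normal subgroup of the coordinates p and s. The left exponent is the
  -- trace of the s-part of z n' z⁻¹.
  have hN : ∀ p01 p02 p12 s00 s10 s11 s20 s21 s22 : F,
      ψ ((s00 + z.g01 * s10 + z.g02 * s20)
        - z.m01 * p01 - z.m02 * (p02 - z.k12 * p01)
        + ((s11 + z.g12 * s21) - z.k01 * (s10 + z.g12 * s20)
        + z.m10 * p01 - z.m12 * (p12 - z.k01 * p02 + z.k02 * p01))
        + (s22 - z.k12 * s21 + (z.k01 * z.k12 - z.k02) * s20
        + z.m20 * (p02 - z.k12 * p01) + z.m21 * (p12 - z.k01 * p02 + z.k02 * p01)))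
      = ψ (s00 + s11 + s22) := by
    intro p01 p02 p12 s00 s10 s11 s20 s21 s22
    let n' : CoreGroup F := { (1 : CoreGroup F) with
      p01 := p01, p02 := p02, p12 := p12, s00 := s00, s10 := s10, s11 := s11, s20 := s20,
      s21 := s21, s22 := s22 }
    -- This is z n' z⁻¹. Left multiplication by an element of the subgroup of the p, s just adds
    -- coordinates, so differences recover it.
    let n : CoreGroup F := { (1 : CoreGroup F) with
      p01 := (z * n').p01 - z.p01
      p02 := (z * n').p02 - z.p02
      p12 := (z * n').p12 - z.p12
      s00 := (z * n').s00 - z.s00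
      s10 := (z * n').s10 - z.s10
      s11 := (z * n').s11 - z.s11
      s20 := (z * n').s20 - z.s20
      s21 := (z * n').s21 - z.s21
      s22 := (z * n').s22 - z.s22 }
    have key := h n n' ⟨rfl, rfl, rfl, rfl, rfl, rfl, Λ.q.act_zero⟩
      ⟨rfl, rfl, rfl, rfl, rfl, rfl, Λ'.q.act_zero⟩
      (by ext <;> simp only [n, n', mul_def, mul, one_def] <;> ring)
    convert key using 2
    · simp only [n, n', exponent, TernaryForm.pair, mul_def, mul, one_def]
      ring
    · simp only [n', exponent, TernaryForm.pair, one_def]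
      ring
  -- The coefficients of s10, s21, s20 force k = g; afterwards those of p12, p02, p01, in this
  -- order, force m to be symmetric.
  have h01 : z.k01 = z.g01 := by
    refine (sub_eq_zero.mp (AddChar.eq_zero_of_forall_eq hψ _ _ (fun t => hN 0 0 0 0 t 0 0 0 0)
      fun t => ?_)).symm
    ring
  have h12 : z.k12 = z.g12 := by
    refine (sub_eq_zero.mp (AddChar.eq_zero_of_forall_eq hψ _ _ (fun t => hN 0 0 0 0 0 0 0 t 0)
      fun t => ?_)).symm
    ring
  have h02 : z.k02 = z.g02 := by
    refine (sub_eq_zero.mp (AddChar.eq_zero_of_forall_eq hψ _ _ (fun t => hN 0 0 0 0 0 0 t 0 0)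
      fun t => ?_)).symm
    rw [h01, h12]
    ring
  have m21 : z.m21 = z.m12 := by
    refine sub_eq_zero.mp (AddChar.eq_zero_of_forall_eq hψ _ _ (fun t => hN 0 0 t 0 0 0 0 0 0)
      fun t => ?_)
    ring
  have m20 : z.m20 = z.m02 := by
    refine sub_eq_zero.mp (AddChar.eq_zero_of_forall_eq hψ _ _ (fun t => hN 0 t 0 0 0 0 0 0 0)
      fun t => ?_)
    rw [m21]
    ring
  have m10 : z.m10 = z.m01 := by
    refine sub_eq_zero.mp (AddChar.eq_zero_of_forall_eq hψ _ _ (fun t => hN t 0 0 0 0 0 0 0 0)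
      fun t => ?_)
    rw [m21, m20]
    ring
  refine ⟨⟨h01, h12, h02⟩, ⟨m10, m20, m21⟩, ?_⟩
  -- Second test, on symmetric matrices m, where conjugation by `z` acts on the forms by
  -- substitution.
  have hM : ∀ m00 m01 m02 m11 m12 m22 : F,
      ψ ((Λ.q.act z.g01 z.g02 z.g12).pair ({ (1 : CoreGroup F) with
        m00 := m00, m01 := m01, m02 := m02, m11 := m11, m12 := m12, m22 := m22 } : CoreGroup F)) =
      ψ (Λ'.q.pair ({ (1 : CoreGroup F) with
        m00 := m00, m01 := m01, m02 := m02, m11 := m11, m12 := m12, m22 := m22 }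
          : CoreGroup F)) := by
    intro m00 m01 m02 m11 m12 m22
    let n' : CoreGroup F := { (1 : CoreGroup F) with
      m00 := m00, m01 := m01, m02 := m02, m10 := m01, m11 := m11, m12 := m12, m20 := m02,
      m21 := m12, m22 := m22 }
    let n₀ : CoreGroup F := { (1 : CoreGroup F) with
      m00 := (z * n').m00 - z.m00
      m01 := (z * n').m01 - z.m01
      m02 := (z * n').m02 - z.m02
      m10 := (z * n').m10 - z.m10
      m11 := (z * n').m11 - z.m11
      m12 := (z * n').m12 - z.m12
      m20 := (z * n').m20 - z.m20
      m21 := (z * n').m21 - z.m21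
      m22 := (z * n').m22 - z.m22 }
    -- `n₀` is z n' z⁻¹ up to the coordinates s; adjusting these makes n z = z n' exact.
    let n : CoreGroup F := { n₀ with
      s00 := z.s00 - (n₀ * z).s00
      s10 := z.s10 - (n₀ * z).s10
      s11 := z.s11 - (n₀ * z).s11
      s20 := z.s20 - (n₀ * z).s20
      s21 := z.s21 - (n₀ * z).s21
      s22 := z.s22 - (n₀ * z).s22 }
    have s10 : n₀.m10 = n₀.m01 := by
      simp only [n₀, n', mul_def, mul, one_def, h01, h12, h02, m10, m20, m21]
      ring
    have s20 : n₀.m20 = n₀.m02 := by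
      simp only [n₀, n', mul_def, mul, one_def, h01, h12, h02, m10, m20, m21]
      ring
    have s21 : n₀.m21 = n₀.m12 := by
      simp only [n₀, n', mul_def, mul, one_def, h01, h12, h02, m10, m20, m21]
      ring
    have hnz : n * z = z * n' := by
      ext <;> simp only [n, n₀, n', mul_def, mul, one_def] <;> ring
    have key := h n n' ⟨rfl, rfl, rfl, s10, s20, s21, Λ.q.act_zero⟩
      ⟨rfl, rfl, rfl, rfl, rfl, rfl, Λ'.q.act_zero⟩ hnz
    have e1 : Λ.exponent n = Λ.q.pair n₀ := by
      -- The adjustment has trace 0, again because symmetric and alternating matrices are orthogonal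
      -- for the trace.
      have : (n₀ * z).s00 + (n₀ * z).s11 + (n₀ * z).s22 = z.s00 + z.s11 + z.s22 := by
        have g01 : n₀.g01 = 0 := rfl
        have g02 : n₀.g02 = 0 := rfl
        have g12 : n₀.g12 = 0 := rfl
        have k01 : n₀.k01 = 0 := rfl
        have k02 : n₀.k02 = 0 := rfl
        have k12 : n₀.k12 = 0 := rfl
        have s00 : n₀.s00 = 0 := rfl
        have s11 : n₀.s11 = 0 := rfl
        have s22 : n₀.s22 = 0 := rfl
        simp only [mul_def, mul, g01, g02, g12, k01, k02, k12, s00, s11, s22, s10, s20, s21]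
        ring
      have e2 : Λ.exponent n = z.s00 + z.s11 + z.s22
          - ((n₀ * z).s00 + (n₀ * z).s11 + (n₀ * z).s22) + Λ.q.pair n₀ := by
        simp only [exponent, n, TernaryForm.pair]
        simp only [n₀, one_def]
        ring
      rw [e2, this, sub_self, zero_add]
    have e3 : Λ.q.pair n₀ = (Λ.q.act z.g01 z.g02 z.g12).pair n' := by
      have := pair_mul Λ.q z n' h01 h12 h02 rfl rfl rfl
      simp only [TernaryForm.pair, n₀] at this ⊢
      linear_combination this
    have e4 : Λ'.exponent n' = Λ'.q.pair n' := by
      simp only [exponent, n', TernaryForm.pair, one_def]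
      ring
    rw [e1, e3, e4] at key
    exact key
  ext
  · exact hq
  · refine sub_eq_zero.mp (AddChar.eq_zero_of_forall_eq hψ _ _ (fun t => hM 0 t 0 0 0 0)
      fun t => ?_)
    simp only [TernaryForm.pair]; ring
  · refine sub_eq_zero.mp (AddChar.eq_zero_of_forall_eq hψ _ _ (fun t => hM 0 0 t 0 0 0)
      fun t => ?_)
    simp only [TernaryForm.pair]; ring
  · refine sub_eq_zero.mp (AddChar.eq_zero_of_forall_eq hψ _ _ (fun t => hM 0 0 0 t 0 0)
      fun t => ?_)
    simp only [TernaryForm.pair]; ring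
  · refine sub_eq_zero.mp (AddChar.eq_zero_of_forall_eq hψ _ _ (fun t => hM 0 0 0 0 t 0)
      fun t => ?_)
    simp only [TernaryForm.pair]; ring
  · refine sub_eq_zero.mp (AddChar.eq_zero_of_forall_eq hψ _ _ (fun t => hM 0 0 0 0 0 t)
      fun t => ?_)
    simp only [TernaryForm.pair]; ring

theorem intertwine_linearDatum (hψ : ψ ≠ 1) (Λ Λ' : StabLabel F) (hq : Λ.q.a = Λ'.q.a)
    (z : CoreGroup F)
    (h : ∀ k ∈ (Λ.linearDatum ψ).K, z⁻¹ * k * z ∈ (Λ'.linearDatum ψ).K →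
      (Λ.linearDatum ψ).μ k = (Λ'.linearDatum ψ).μ (z⁻¹ * k * z)) :
    (z.k01 = z.g01 ∧ z.k12 = z.g12 ∧ z.k02 = z.g02) ∧
      (z.m10 = z.m01 ∧ z.m20 = z.m02 ∧ z.m21 = z.m12) ∧
      Λ.q.act z.g01 z.g02 z.g12 = Λ'.q := by
  refine intertwine hψ Λ Λ' hq z fun n n' hn hn' e => ?_
  have e' : z⁻¹ * n * z = n' := by rw [mul_assoc, e, inv_mul_cancel_left]
  have := h n hn (by rw [e']; exact hn')
  rwa [e', linearDatum_μ Λ ψ hn, linearDatum_μ Λ' ψ hn'] at this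

/-- For Λ' = Λ the conclusion of `intertwine` says precisely that `z` lies in the inducing subgroup;
this is Mackey's criterion. -/
theorem irreducible_aux (hψ : ψ ≠ 1) : ∀ z ∉ (Λ.linearDatum ψ).K, ∃ k ∈ (Λ.linearDatum ψ).K,
    z⁻¹ * k * z ∈ (Λ.linearDatum ψ).K ∧
      (Λ.linearDatum ψ).μ k ≠ (Λ.linearDatum ψ).μ (z⁻¹ * k * z) := by
  intro z hz
  by_contra! h
  obtain ⟨⟨h1, h2, h3⟩, ⟨h4, h5, h6⟩, h7⟩ := intertwine_linearDatum hψ Λ Λ rfl z h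
  exact hz ⟨h1, h2, h3, h4, h5, h6, h7⟩

theorem indChar_mem_Irr (hψ : ψ ≠ 1) : (Λ.linearDatum ψ).indChar ∈ Irr (CoreGroup F) :=
  LinearDatum.indChar_mem_Irr _ (irreducible_aux Λ hψ)

theorem charProd_self (hψ : ψ ≠ 1) :
    charProd (Λ.linearDatum ψ).indChar (Λ.linearDatum ψ).indChar = 1 :=
  LinearDatum.charProd_indChar_self _ (irreducible_aux Λ hψ)

/-- Labels with equal characters have quadratic forms in the same orbit, and equal linear
functionals if the quadratic forms are equal. -/
theorem indChar_injective (hψ : ψ ≠ 1) (Λ Λ' : StabLabel F) (hq : Λ.q.a = Λ'.q.a)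
    (h : (Λ.linearDatum ψ).indChar = (Λ'.linearDatum ψ).indChar) :
    (∃ r s t, Λ.q.act r s t = Λ'.q) ∧ (Λ.q = Λ'.q → ∀ r s t, Λ.q.act r s t = Λ.q →
      ψ (Λ.e₁ * r + Λ.e₂ * s + Λ.e₃ * t) = ψ (Λ'.e₁ * r + Λ'.e₂ * s + Λ'.e₃ * t)) := by
  have h1 := charProd_self Λ hψ
  have h2 : ∃ z : CoreGroup F, ∀ k ∈ (Λ.linearDatum ψ).K, z⁻¹ * k * z ∈ (Λ'.linearDatum ψ).K →
      (Λ.linearDatum ψ).μ k = (Λ'.linearDatum ψ).μ (z⁻¹ * k * z) := by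
    by_contra! h2
    have h3 := LinearDatum.charProd_indChar_eq_zero _ _ h2
    rw [← h, h1] at h3
    exact one_ne_zero h3
  obtain ⟨z, hz⟩ := h2
  obtain ⟨⟨h1, h2, h3⟩, ⟨h4, h5, h6⟩, h7⟩ := intertwine_linearDatum hψ Λ Λ' hq z hz
  refine ⟨⟨_, _, _, h7⟩, fun heq r s t hr => ?_⟩
  -- If the forms agree, `z` lies in the common inducing subgroup, so conjugation by it does not
  -- affect the linear characters; they are compared on pure unitriangular elements.
  have hzK' : MemStab Λ'.q z := ⟨h1, h2, h3, h4, h5, h6, by rw [← heq, h7, heq]⟩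
  let k : CoreGroup F := { (1 : CoreGroup F) with
    g01 := r, g02 := s, g12 := t, k01 := r, k02 := s, k12 := t }
  have hk : MemStab Λ.q k := ⟨rfl, rfl, rfl, rfl, rfl, rfl, hr⟩
  have hk' : MemStab Λ'.q k := heq ▸ hk
  have hzi := (stabGroup Λ'.q).inv_mem hzK'
  have h8 := hz k hk ((stabGroup Λ'.q).mul_mem ((stabGroup Λ'.q).mul_mem hzi hk') hzK')
  rw [LinearDatum.map_mul_right _ _ hzK', LinearDatum.map_mul_right _ _ hk', mul_right_comm,
    mul_comm _ ((Λ'.linearDatum ψ).μ z), LinearDatum.map_mul_inv _ hzK', one_mul,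
    linearDatum_μ Λ ψ hk, linearDatum_μ Λ' ψ hk'] at h8
  convert h8 using 2 <;> simp [exponent, k, one_def, TernaryForm.pair]

/-- The index of the inducing subgroup is q²⁴ / (|Stab| q¹⁵). -/
theorem indChar_one : (Λ.linearDatum ψ).indChar 1 =
    (Nat.card F : ℂ) ^ 9 / Nat.card Λ.q.Stab := by
  have hF : (Nat.card F : ℂ) ≠ 0 := by exact_mod_cast Nat.card_pos.ne'
  have : (Nat.card Λ.q.Stab : ℂ) ≠ 0 := by
    have : Nonempty Λ.q.Stab := ⟨⟨(0, 0, 0), Λ.q.act_zero⟩⟩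
    exact_mod_cast Nat.card_pos.ne'
  rw [LinearDatum.indChar_one, linearDatum_K, card_stabGroup, CoreGroup.card_eq]
  push_cast
  field_simp

end StabLabel

/-! ### Completeness of the families of characters -/

namespace CoreGroup

variable {F : Type*} [Field F]

/-- The elements of the product of the root subgroups of the highest roots. -/
def central (w x y z : F) : CoreGroup F :=
  { (1 : CoreGroup F) with m00 := w, s00 := x, s11 := y, s22 := z }

theorem central_mul (w x y z : F) (e : CoreGroup F) :
    central w x y z * e = e * central w x y z := by
  ext <;> simp only [central, mul_def, mul, one_def] <;> ring

theorem central_mul_central (w x y z w' x' y' z' : F) : central w x y z * central w' x' y' z' =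
    central (w + w') (x + x') (y + y') (z + z') := by
  ext <;> simp only [central, mul_def, mul, one_def] <;> ring

theorem memStab_central (q : TernaryForm F) (w x y z : F) : MemStab q (central w x y z) :=
  ⟨rfl, rfl, rfl, rfl, rfl, rfl, q.act_zero⟩

theorem exponent_central (Λ : StabLabel F) (w x y z : F) :
    Λ.exponent (central w x y z) = x + y + z + Λ.q.a * w := by
  simp [StabLabel.exponent, central, one_def, TernaryForm.pair]

variable [Finite F]

/-- The group of the elements `central w x y z`. -/
def centralGroup (F : Type*) [Field F] [Finite F] : Subgroup (CoreGroup F) :=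
  Subgroup.ofMulClosed {e | ∃ w x y z, e = central w x y z} ⟨0, 0, 0, 0, rfl⟩ <| by
    rintro _ ⟨w, x, y, z, rfl⟩ _ ⟨w', x', y', z', rfl⟩
    exact ⟨_, _, _, _, central_mul_central ..⟩

theorem card_centralGroup : Nat.card (centralGroup F) = Nat.card F ^ 4 := by
  have e : F × F × F × F ≃ centralGroup F := Equiv.ofBijective
    (fun t => ⟨central t.1 t.2.1 t.2.2.1 t.2.2.2, _, _, _, _, rfl⟩) <| by
    constructor
    · rintro ⟨w, x, y, z⟩ ⟨w', x', y', z'⟩ h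
      have h := Subtype.ext_iff.mp h
      simpa [central] using h
    · rintro ⟨_, w, x, y, z, rfl⟩
      exact ⟨(w, x, y, z), rfl⟩
  rw [← Nat.card_congr e]
  simp only [Nat.card_prod]
  ring

open Classical in
/-- The linear character of `centralGroup F` with parameter `a`. -/
noncomputable def centralDatum (ψ : AddChar F ℂ) (a : F) : LinearDatum (CoreGroup F) where
  K := centralGroup F
  μ e := if e ∈ centralGroup F then ψ (e.s00 + e.s11 + e.s22 + a * e.m00) else 0
  map_one := by
    rw [if_pos (one_mem _)]
    simp [one_def]
  map_mul := by
    intro e he f hf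
    rw [if_pos he, if_pos hf, if_pos (mul_mem he hf), ← AddChar.map_add_eq_mul]
    obtain ⟨w, x, y, z, rfl⟩ := he
    obtain ⟨w', x', y', z', rfl⟩ := hf
    rw [central_mul_central]
    simp only [central]
    ring_nf
  map_zero x hx := if_neg hx
  map_star := by
    intro e he
    rw [if_pos he, if_pos (inv_mem he)]
    obtain ⟨w, x, y, z, rfl⟩ := he
    have : (central w x y z)⁻¹ = central (-w) (-x) (-y) (-z) := by
      rw [inv_eq_iff_mul_eq_one, central_mul_central]
      simp [central, one_def]
    rw [this]
    change (starRingEnd ℂ) _ = _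
    rw [← AddChar.map_neg_eq_conj]
    simp only [central]
    ring_nf

end CoreGroup

namespace StabLabel

open CoreGroup

variable {F : Type*} [Field F] [Finite F] {ψ : AddChar F ℂ}

theorem indChar_central (Λ : StabLabel F) (w x y z : F) :
    (Λ.linearDatum ψ).indChar (central w x y z) =
      (Λ.linearDatum ψ).indChar 1 * ψ (x + y + z + Λ.q.a * w) := by
  rw [LinearDatum.indChar_central _ (central_mul w x y z), LinearDatum.indChar_one,
    linearDatum_μ Λ ψ (memStab_central Λ.q w x y z), exponent_central]

/-- A set of labels, one for each orbit of quadratic forms with leading coefficient `a` and each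
linear character of the stabilizer, up to the last condition. -/
structure IsTransversal {L : Type*} [Fintype L] (ψ : AddChar F ℂ) (a : F) (Λ : L → StabLabel F) :
    Prop where
  leading : ∀ ℓ, (Λ ℓ).q.a = a
  orbit : ∀ ℓ m r s t, (Λ ℓ).q.act r s t = (Λ m).q → (Λ ℓ).q = (Λ m).q
  linear : ∀ ℓ m, (Λ ℓ).q = (Λ m).q → (∀ r s t, (Λ ℓ).q.act r s t = (Λ ℓ).q →
    ψ ((Λ ℓ).e₁ * r + (Λ ℓ).e₂ * s + (Λ ℓ).e₃ * t) =
      ψ ((Λ m).e₁ * r + (Λ m).e₂ * s + (Λ m).e₃ * t)) → ℓ = m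
  -- If each stabilizer carries |Stab| labels, this sum is the sum of 1/|Stab| over the orbits,
  -- which is q⁵/q³.
  sum_eq : ∑ ℓ, (1 / (Nat.card (Λ ℓ).q.Stab : ℂ)) ^ 2 = (Nat.card F : ℂ) ^ 2

namespace IsTransversal

variable {L : Type*} [Fintype L] {a : F} {Λ : L → StabLabel F}

theorem injective (h : IsTransversal ψ a Λ) (hψ : ψ ≠ 1) :
    Function.Injective fun ℓ => ((Λ ℓ).linearDatum ψ).indChar := by
  intro ℓ m hℓ
  obtain ⟨⟨r, s, t, h1⟩, h2⟩ := indChar_injective hψ (Λ ℓ) (Λ m)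
    ((h.leading ℓ).trans (h.leading m).symm) hℓ
  have h3 := h.orbit ℓ m r s t h1
  exact h.linear ℓ m h3 (h2 h3)

/-- The degrees are q⁹/|Stab|, so the squares add up to q¹⁸ q² = q²⁴/q⁴, as the completeness
criterion requires. -/
theorem exists_eq (h : IsTransversal ψ a Λ) (hψ : ψ ≠ 1) {χ : CoreGroup F → ℂ}
    (hχ : χ ∈ Irr (CoreGroup F))
    (hc : ∀ w x y z, χ (central w x y z) = χ 1 * ψ (x + y + z + a * w)) :
    ∃ ℓ, χ = ((Λ ℓ).linearDatum ψ).indChar := by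
  have hF : (Nat.card F : ℂ) ≠ 0 := by exact_mod_cast Nat.card_pos.ne'
  have hμ : ∀ w x y z, (centralDatum ψ a).μ (central w x y z) = ψ (x + y + z + a * w) :=
    fun w x y z => if_pos ⟨w, x, y, z, rfl⟩
  refine exists_eq_indChar (centralDatum ψ a) ?_ (fun ℓ => (Λ ℓ).linearDatum ψ)
    (fun ℓ => indChar_mem_Irr _ hψ) (fun ℓ => charProd_self _ hψ) (h.injective hψ) ?_ ?_ hχ ?_
  · rintro _ ⟨w, x, y, z, rfl⟩ g
    exact central_mul w x y z g
  · rintro ℓ _ ⟨w, x, y, z, rfl⟩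
    refine ⟨memStab_central _ w x y z, ?_⟩
    rw [hμ, linearDatum_μ _ ψ (memStab_central _ w x y z), exponent_central, h.leading]
  · have : ∀ ℓ, ((Λ ℓ).linearDatum ψ).indChar 1 * ((Λ ℓ).linearDatum ψ).indChar 1 =
        (Nat.card F : ℂ) ^ 18 * (1 / (Nat.card (Λ ℓ).q.Stab : ℂ)) ^ 2 := fun ℓ => by
      rw [StabLabel.indChar_one]
      ring
    simp only [this, ← Finset.mul_sum, h.sum_eq]
    change _ = _ / (Nat.card (centralGroup F) : ℂ)
    rw [card_centralGroup, CoreGroup.card_eq]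
    push_cast
    field_simp
  · rintro _ ⟨w, x, y, z, rfl⟩
    rw [hc, hμ, mul_comm]

end IsTransversal

end StabLabel

/-! ### The quattern group in coordinates -/

section Coordinates

variable {F : Type*} [Field F]

open Matrix

/-- The coordinates of the element with upper left block `A` and upper right block `S A⁻ᵀ`. -/
def coreCoord (A S : Matrix (Fin 6) (Fin 6) F) : CoreGroup F where
  g01 := A 0 1
  g12 := A 1 2
  g02 := A 0 2
  -- Indices 3, 4, 5 are read backwards, as 5 - j. If A has diagonal blocks g, K and upper right
  -- block X, then k is K⁻¹ reflected in the antidiagonal, m is X K⁻¹ with reversed columns, and p,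
  -- s are blocks of S. The entries of S not read belong to roots of height at least 6.
  k01 := -A 4 5
  k12 := -A 3 4
  k02 := A 3 4 * A 4 5 - A 3 5
  m00 := A 0 5 - A 0 4 * A 4 5 + A 0 3 * (A 3 4 * A 4 5 - A 3 5)
  m01 := A 0 4 - A 0 3 * A 3 4
  m02 := A 0 3
  m10 := A 1 5 - A 1 4 * A 4 5 + A 1 3 * (A 3 4 * A 4 5 - A 3 5)
  m11 := A 1 4 - A 1 3 * A 3 4
  m12 := A 1 3
  m20 := A 2 5 - A 2 4 * A 4 5 + A 2 3 * (A 3 4 * A 4 5 - A 3 5)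
  m21 := A 2 4 - A 2 3 * A 3 4
  m22 := A 2 3
  p01 := -S 4 5
  p02 := -S 3 5
  p12 := -S 3 4
  s00 := S 0 5
  s10 := S 1 5
  s11 := S 1 4
  s20 := S 2 5
  s21 := S 2 4
  s22 := S 2 3

/-- An upper unitriangular matrix. -/
structure IsUnitriangular (A : Matrix (Fin 6) (Fin 6) F) : Prop where
  diag : ∀ i, A i i = 1
  lower : ∀ i j, j < i → A i j = 0

theorem IsUnitriangular.mul {A A' : Matrix (Fin 6) (Fin 6) F} (h : IsUnitriangular A)
    (h' : IsUnitriangular A') : IsUnitriangular (A * A') where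
  diag i := by
    rw [Matrix.mul_apply, Finset.sum_eq_single i, h.diag, h'.diag, one_mul]
    · intro k _ hk
      rcases lt_or_gt_of_ne hk with hk | hk
      · rw [h.lower _ _ hk, zero_mul]
      · rw [h'.lower _ _ hk, mul_zero]
    · simp
  lower i j hij := by
    rw [Matrix.mul_apply]
    refine Finset.sum_eq_zero fun k _ => ?_
    rcases lt_or_ge k i with hk | hk
    · rw [h.lower _ _ hk, zero_mul]
    · rw [h'.lower _ _ (lt_of_lt_of_le hij hk), mul_zero]

/-- In the pairs (A, S) the group law is (A A', S + A S' Aᵀ). The form T - Tᵀ of S' encodes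
alternating, including the zero diagonal in characteristic 2. -/
theorem coreCoord_mul {A A' : Matrix (Fin 6) (Fin 6) F} (h : IsUnitriangular A)
    (h' : IsUnitriangular A') (S T : Matrix (Fin 6) (Fin 6) F) :
    coreCoord (A * A') (S + A * (T - Tᵀ) * Aᵀ) = coreCoord A S * coreCoord A' (T - Tᵀ) := by
  have e10 : (1 : Fin 6) > 0 := by decide
  have e20 : (2 : Fin 6) > 0 := by decide
  have e21 : (2 : Fin 6) > 1 := by decide
  have e30 : (3 : Fin 6) > 0 := by decide
  have e31 : (3 : Fin 6) > 1 := by decide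
  have e32 : (3 : Fin 6) > 2 := by decide
  have e40 : (4 : Fin 6) > 0 := by decide
  have e41 : (4 : Fin 6) > 1 := by decide
  have e42 : (4 : Fin 6) > 2 := by decide
  have e43 : (4 : Fin 6) > 3 := by decide
  have e50 : (5 : Fin 6) > 0 := by decide
  have e51 : (5 : Fin 6) > 1 := by decide
  have e52 : (5 : Fin 6) > 2 := by decide
  have e53 : (5 : Fin 6) > 3 := by decide
  have e54 : (5 : Fin 6) > 4 := by decide
  ext <;>
    simp only [coreCoord, CoreGroup.mul_def, CoreGroup.mul, Matrix.mul_apply, Matrix.add_apply,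
      Matrix.sub_apply, Matrix.transpose_apply, Fin.sum_univ_six, h.diag, h'.diag,
      h.lower _ _ e10, h.lower _ _ e20, h.lower _ _ e21, h.lower _ _ e30, h.lower _ _ e31,
      h.lower _ _ e32, h.lower _ _ e40, h.lower _ _ e41, h.lower _ _ e42, h.lower _ _ e43,
      h.lower _ _ e50, h.lower _ _ e51, h.lower _ _ e52, h.lower _ _ e53, h.lower _ _ e54,
      h'.lower _ _ e21, h'.lower _ _ e31, h'.lower _ _ e32, h'.lower _ _ e41, h'.lower _ _ e42,
      h'.lower _ _ e43, h'.lower _ _ e51, h'.lower _ _ e52, h'.lower _ _ e53, h'.lower _ _ e54,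
      zero_mul, mul_zero, zero_add, add_zero, one_mul, mul_one] <;> ring

/-- The shape of the elements of the group generated by the root elements. -/
structure IsUnipotentD (M : Matrix (Fin 6 ⊕ Fin 6) (Fin 6 ⊕ Fin 6) F) : Prop where
  unitriangular : IsUnitriangular M.toBlocks₁₁
  lower : M.toBlocks₂₁ = 0
  dual : M.toBlocks₂₂ * M.toBlocks₁₁ᵀ = 1
  alternating : ∃ T, M.toBlocks₁₂ * M.toBlocks₁₁ᵀ = T - Tᵀ

theorem toBlocks_mul (M N : Matrix (Fin 6 ⊕ Fin 6) (Fin 6 ⊕ Fin 6) F) :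
    (M * N).toBlocks₁₁ = M.toBlocks₁₁ * N.toBlocks₁₁ + M.toBlocks₁₂ * N.toBlocks₂₁ ∧
    (M * N).toBlocks₁₂ = M.toBlocks₁₁ * N.toBlocks₁₂ + M.toBlocks₁₂ * N.toBlocks₂₂ ∧
    (M * N).toBlocks₂₁ = M.toBlocks₂₁ * N.toBlocks₁₁ + M.toBlocks₂₂ * N.toBlocks₂₁ ∧
    (M * N).toBlocks₂₂ = M.toBlocks₂₁ * N.toBlocks₁₂ + M.toBlocks₂₂ * N.toBlocks₂₂ := by
  have : M * N = fromBlocks M.toBlocks₁₁ M.toBlocks₁₂ M.toBlocks₂₁ M.toBlocks₂₂ *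
      fromBlocks N.toBlocks₁₁ N.toBlocks₁₂ N.toBlocks₂₁ N.toBlocks₂₂ := by
    rw [fromBlocks_toBlocks, fromBlocks_toBlocks]
  rw [this, fromBlocks_multiply]
  simp

theorem toBlocks_one : (1 : Matrix (Fin 6 ⊕ Fin 6) (Fin 6 ⊕ Fin 6) F).toBlocks₁₁ = 1 ∧
    (1 : Matrix (Fin 6 ⊕ Fin 6) (Fin 6 ⊕ Fin 6) F).toBlocks₁₂ = 0 ∧
    (1 : Matrix (Fin 6 ⊕ Fin 6) (Fin 6 ⊕ Fin 6) F).toBlocks₂₁ = 0 ∧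
    (1 : Matrix (Fin 6 ⊕ Fin 6) (Fin 6 ⊕ Fin 6) F).toBlocks₂₂ = 1 := by
  rw [← fromBlocks_one, toBlocks_fromBlocks₁₁, toBlocks_fromBlocks₁₂, toBlocks_fromBlocks₂₁,
    toBlocks_fromBlocks₂₂]
  exact ⟨rfl, rfl, rfl, rfl⟩

namespace IsUnipotentD

variable {M N : Matrix (Fin 6 ⊕ Fin 6) (Fin 6 ⊕ Fin 6) F}

theorem mul_blocks (hM : IsUnipotentD M) (hN : IsUnipotentD N) :
    (M * N).toBlocks₁₁ = M.toBlocks₁₁ * N.toBlocks₁₁ ∧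
    (M * N).toBlocks₁₂ * (M * N).toBlocks₁₁ᵀ = M.toBlocks₁₂ * M.toBlocks₁₁ᵀ +
      M.toBlocks₁₁ * (N.toBlocks₁₂ * N.toBlocks₁₁ᵀ) * M.toBlocks₁₁ᵀ ∧
    (M * N).toBlocks₂₁ = 0 ∧ (M * N).toBlocks₂₂ = M.toBlocks₂₂ * N.toBlocks₂₂ := by
  obtain ⟨h1, h2, h3, h4⟩ := toBlocks_mul M N
  rw [hN.lower, mul_zero, add_zero] at h1
  refine ⟨h1, ?_, ?_, ?_⟩
  · rw [h1, h2, transpose_mul, add_mul]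
    have : M.toBlocks₁₂ * N.toBlocks₂₂ * (N.toBlocks₁₁ᵀ * M.toBlocks₁₁ᵀ) =
        M.toBlocks₁₂ * (N.toBlocks₂₂ * N.toBlocks₁₁ᵀ) * M.toBlocks₁₁ᵀ := by
      simp only [Matrix.mul_assoc]
    rw [this, hN.dual, mul_one, add_comm]
    simp only [Matrix.mul_assoc]
  · rw [h3, hM.lower, hN.lower, zero_mul, mul_zero, add_zero]
  · rw [h4, hM.lower, zero_mul, zero_add]

theorem mul (hM : IsUnipotentD M) (hN : IsUnipotentD N) : IsUnipotentD (M * N) := by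
  obtain ⟨h1, h2, h3, h4⟩ := mul_blocks hM hN
  refine ⟨h1 ▸ hM.unitriangular.mul hN.unitriangular, h3, ?_, ?_⟩
  · rw [h4, h1, transpose_mul]
    have : M.toBlocks₂₂ * N.toBlocks₂₂ * (N.toBlocks₁₁ᵀ * M.toBlocks₁₁ᵀ) =
        M.toBlocks₂₂ * (N.toBlocks₂₂ * N.toBlocks₁₁ᵀ) * M.toBlocks₁₁ᵀ := by
      simp only [Matrix.mul_assoc]
    rw [this, hN.dual, mul_one, hM.dual]
  · obtain ⟨T, hT⟩ := hM.alternating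
    obtain ⟨T', hT'⟩ := hN.alternating
    refine ⟨T + M.toBlocks₁₁ * T' * M.toBlocks₁₁ᵀ, ?_⟩
    rw [h2, hT, hT']
    simp only [transpose_add, transpose_mul, transpose_transpose, mul_sub, sub_mul,
      Matrix.mul_assoc]
    abel

end IsUnipotentD

/-- The coordinates of a matrix. -/
def matrixCoord (M : Matrix (Fin 6 ⊕ Fin 6) (Fin 6 ⊕ Fin 6) F) : CoreGroup F :=
  coreCoord M.toBlocks₁₁ (M.toBlocks₁₂ * M.toBlocks₁₁ᵀ)

theorem matrixCoord_mul {M N : Matrix (Fin 6 ⊕ Fin 6) (Fin 6 ⊕ Fin 6) F} (hM : IsUnipotentD M)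
    (hN : IsUnipotentD N) : matrixCoord (M * N) = matrixCoord M * matrixCoord N := by
  obtain ⟨h1, h2, -, -⟩ := hM.mul_blocks hN
  obtain ⟨T, hT⟩ := hN.alternating
  rw [matrixCoord, h2, h1, hT, coreCoord_mul hM.unitriangular hN.unitriangular, ← hT]
  rfl

/-! ### Root elements in coordinates, and the kernel of the coordinate map -/

theorem rootElt_false (i j : Fin 6) (h : i < j) (t : F) :
    (rootElt ⟨(i, j, false), h⟩ t : Matrix (Fin 6 ⊕ Fin 6) (Fin 6 ⊕ Fin 6) F) =
      fromBlocks (1 + single i j t) 0 0 (1 - single j i t) := by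
  change 1 + t • rootVector F _ = _
  ext (k | k) (l | l) <;> simp [rootVector, Matrix.single_apply, Matrix.one_apply, sub_eq_add_neg]

theorem rootElt_true (i j : Fin 6) (h : i < j) (t : F) :
    (rootElt ⟨(i, j, true), h⟩ t : Matrix (Fin 6 ⊕ Fin 6) (Fin 6 ⊕ Fin 6) F) =
      fromBlocks 1 (single i j t - single j i t) 0 1 := by
  change 1 + t • rootVector F _ = _
  ext (k | k) (l | l) <;> simp [rootVector, Matrix.single_apply, Matrix.one_apply, mul_sub]

theorem isUnitriangular_one : IsUnitriangular (1 : Matrix (Fin 6) (Fin 6) F) :=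
  ⟨fun _ => Matrix.one_apply_eq _, fun _ _ h => Matrix.one_apply_ne h.ne'⟩

theorem isUnipotentD_rootElt (α : PosRoot) (t : F) :
    IsUnipotentD (rootElt α t : Matrix (Fin 6 ⊕ Fin 6) (Fin 6 ⊕ Fin 6) F) := by
  obtain ⟨⟨i, j, s⟩, h⟩ := α
  change i < j at h
  cases s
  · rw [rootElt_false]
    refine ⟨?_, by simp, ?_, 0, by simp⟩
    · rw [toBlocks_fromBlocks₁₁]
      refine ⟨fun k => ?_, fun k l hkl => ?_⟩
      · have : ¬ (i = k ∧ j = k) := by rintro ⟨rfl, rfl⟩; exact lt_irrefl _ h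
        simp [this]
      · have : ¬ (i = k ∧ j = l) := by rintro ⟨rfl, rfl⟩; exact lt_asymm h hkl
        simp [this, hkl.ne']
    · simp [sub_mul, mul_add, h.ne]
  · rw [rootElt_true]
    exact ⟨by simpa using isUnitriangular_one, by simp, by simp, single i j t, by simp⟩

theorem isUnipotentD_of_mem {u : GL (Fin 6 ⊕ Fin 6) F} {A : Finset PosRoot}
    (hu : u ∈ rootSubgroup F A) :
    IsUnipotentD (u : Matrix (Fin 6 ⊕ Fin 6) (Fin 6 ⊕ Fin 6) F) := by
  induction hu using Subgroup.closure_induction_left with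
  | one =>
    obtain ⟨h1, h2, h3, h4⟩ := toBlocks_one (F := F)
    rw [Units.val_one]
    refine ⟨by rw [h1]; exact isUnitriangular_one, h3, by rw [h1, h4]; simp, 0, by rw [h2]; simp⟩
  | mul_left x hx y _ hy =>
    obtain ⟨α, -, t, rfl⟩ := hx
    exact (isUnipotentD_rootElt α t).mul hy
  | inv_mul_cancel x hx y _ hy =>
    obtain ⟨α, -, t, rfl⟩ := hx
    rw [rootElt_inv]
    exact (isUnipotentD_rootElt α (-t)).mul hy

/-- The coordinates, as a homomorphism. -/
def coordHom : rootSubgroup F coreD6.P →* CoreGroup F where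
  toFun u := matrixCoord (u : GL (Fin 6 ⊕ Fin 6) F)
  map_one' := by
    rw [Subgroup.coe_one, Units.val_one, matrixCoord, toBlocks_one.1, toBlocks_one.2.1]
    ext <;> simp [coreCoord, CoreGroup.one_def]
  map_mul' u v := matrixCoord_mul (isUnipotentD_of_mem u.2) (isUnipotentD_of_mem v.2)

theorem matrixCoord_rootElt_false (i j : Fin 6) (h : i < j) (t : F) :
    matrixCoord (rootElt ⟨(i, j, false), h⟩ t : Matrix (Fin 6 ⊕ Fin 6) (Fin 6 ⊕ Fin 6) F) =
      coreCoord (1 + single i j t) 0 := by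
  rw [rootElt_false, matrixCoord, toBlocks_fromBlocks₁₁, toBlocks_fromBlocks₁₂, zero_mul]

theorem matrixCoord_rootElt_true (i j : Fin 6) (h : i < j) (t : F) :
    matrixCoord (rootElt ⟨(i, j, true), h⟩ t : Matrix (Fin 6 ⊕ Fin 6) (Fin 6 ⊕ Fin 6) F) =
      coreCoord 1 (single i j t - single j i t) := by
  rw [rootElt_true, matrixCoord, toBlocks_fromBlocks₁₁, toBlocks_fromBlocks₁₂, transpose_one,
    mul_one]

theorem PosRoot.height_eq (α : PosRoot) : α.height =
    if α.1.2.2 then 10 - (α.1.1.val : ℤ) - α.1.2.1.val else α.1.2.1.val - (α.1.1.val : ℤ) := by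
  revert α; decide +kernel

/-- A root of height at least 6 is e_i + e_j with i + j ≤ 4, while the coordinates only read entries
S k l with k + l ≥ 5. -/
theorem matrixCoord_rootElt_of_height {α : PosRoot} (h : α ∈ coreD6.K) (t : F) :
    matrixCoord (rootElt α t : Matrix (Fin 6 ⊕ Fin 6) (Fin 6 ⊕ Fin 6) F) = 1 := by
  have h := (Finset.mem_filter.mp h).2
  rw [PosRoot.height_eq] at h
  obtain ⟨⟨i, j, s⟩, hij⟩ := α
  change i < j at hij
  cases s
  · simp only [Bool.false_eq_true, if_false] at h
    omega
  · simp only [if_true] at h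
    rw [matrixCoord_rootElt_true]
    have h0 : ∀ k l : Fin 6, 5 ≤ k.val + l.val → (single i j t - single j i t) k l = 0 := by
      intro k l hkl
      have h1 : ¬ (i = k ∧ j = l) := by rintro ⟨rfl, rfl⟩; omega
      have h2 : ¬ (j = k ∧ i = l) := by rintro ⟨rfl, rfl⟩; omega
      rw [Matrix.sub_apply, Matrix.single_apply, Matrix.single_apply, if_neg h1, if_neg h2,
        sub_zero]
    ext <;> simp only [coreCoord, CoreGroup.one_def] <;> first
      | (rw [h0 _ _ (by decide)]; try rw [neg_zero])
      | simp

theorem one_unip_mul (S S' : Matrix (Fin 6) (Fin 6) F) :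
    fromBlocks (1 : Matrix (Fin 6) (Fin 6) F) S 0 (1 : Matrix (Fin 6) (Fin 6) F) *
      fromBlocks 1 S' 0 1 = fromBlocks 1 (S + S') 0 1 := by
  simp [fromBlocks_multiply, add_comm]

theorem alternating_eq_sum {S T : Matrix (Fin 6) (Fin 6) F} (hT : S = T - Tᵀ) (b05 : S 0 5 = 0)
    (b14 : S 1 4 = 0) (b15 : S 1 5 = 0) (b23 : S 2 3 = 0) (b24 : S 2 4 = 0) (b25 : S 2 5 = 0)
    (b34 : S 3 4 = 0) (b35 : S 3 5 = 0) (b45 : S 4 5 = 0) :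
    S = single 0 1 (S 0 1) - single 1 0 (S 0 1) + (single 0 2 (S 0 2) - single 2 0 (S 0 2)) +
      (single 0 3 (S 0 3) - single 3 0 (S 0 3)) + (single 0 4 (S 0 4) - single 4 0 (S 0 4)) +
      (single 1 2 (S 1 2) - single 2 1 (S 1 2)) + (single 1 3 (S 1 3) - single 3 1 (S 1 3)) := by
  have hdiag : ∀ i, S i i = 0 := fun i => by rw [hT]; simp
  have hskew : ∀ i j, S j i = -S i j := fun i j => by rw [hT]; simp
  have hzero : ∀ i j, S i j = 0 → S j i = 0 := fun i j h => by rw [hskew, h, neg_zero]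
  ext i j
  fin_cases i <;> fin_cases j <;> simp only [Matrix.add_apply, Matrix.sub_apply] <;> simp <;>
    first | assumption | exact hdiag _ | exact hskew _ _ | (apply hzero; assumption)

/-- Trivial coordinates force A = 1 and leave six free entries of the alternating matrix S, those
with i + j ≤ 4. The element is then the product of the six corresponding root elements. -/
theorem mem_of_coordHom_eq_one (u : rootSubgroup F coreD6.P) (h : coordHom u = 1) :
    (u : GL (Fin 6 ⊕ Fin 6) F) ∈ rootSubgroup F coreD6.K := by
  obtain ⟨u, hu⟩ := u
  obtain ⟨h1, h2, h3, T, h4⟩ := isUnipotentD_of_mem hu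
  change matrixCoord (u : Matrix (Fin 6 ⊕ Fin 6) (Fin 6 ⊕ Fin 6) F) = 1 at h
  rw [matrixCoord] at h
  set A := (u : Matrix (Fin 6 ⊕ Fin 6) (Fin 6 ⊕ Fin 6) F).toBlocks₁₁ with hA
  set S := (u : Matrix (Fin 6 ⊕ Fin 6) (Fin 6 ⊕ Fin 6) F).toBlocks₁₂ * Aᵀ with hS
  simp only [coreCoord, CoreGroup.one_def, CoreGroup.mk.injEq, neg_eq_zero] at h
  obtain ⟨a01, a12, a02, a45, a34, a35, a05, a04, a03, a15, a14, a13, a25, a24, a23, b45, b35, b34,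
    b05, b15, b14, b25, b24, b23⟩ := h
  rw [a34, a45, zero_mul, zero_sub, neg_eq_zero] at a35
  simp only [a34, a03, a13, a23, mul_zero, sub_zero] at a04 a14 a24
  simp only [a45, a34, a35, mul_zero, sub_zero, add_zero] at a05 a15 a25
  have hA1 : A = 1 := by
    ext i j
    rcases lt_trichotomy i j with hij | hij | hij
    · rw [Matrix.one_apply_ne hij.ne]
      fin_cases i <;> fin_cases j <;> first | assumption | exact absurd hij (by decide)
    · rw [hij, h1.diag, Matrix.one_apply_eq]
    · rw [h1.lower _ _ hij, Matrix.one_apply_ne hij.ne']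
  rw [hA1, transpose_one, mul_one] at h3
  have hB : (u : Matrix (Fin 6 ⊕ Fin 6) (Fin 6 ⊕ Fin 6) F).toBlocks₁₂ = S := by
    rw [hS, hA1, transpose_one, mul_one]
  have hu' : u = rootElt ⟨(0, 1, true), by decide⟩ (S 0 1) *
      rootElt ⟨(0, 2, true), by decide⟩ (S 0 2) * rootElt ⟨(0, 3, true), by decide⟩ (S 0 3) *
      rootElt ⟨(0, 4, true), by decide⟩ (S 0 4) * rootElt ⟨(1, 2, true), by decide⟩ (S 1 2) *
      rootElt ⟨(1, 3, true), by decide⟩ (S 1 3) := by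
    apply Units.ext
    rw [Units.val_mul, Units.val_mul, Units.val_mul, Units.val_mul, Units.val_mul]
    simp only [rootElt_true, one_unip_mul]
    rw [← fromBlocks_toBlocks (u : Matrix (Fin 6 ⊕ Fin 6) (Fin 6 ⊕ Fin 6) F), h2, h3, hB, ← hA, hA1]
    congr 1
    exact alternating_eq_sum h4 b05 b14 b15 b23 b24 b25 b34 b35 b45
  change u ∈ _
  rw [hu']
  have hK : ∀ (i j : Fin 6) (hij : i < j), i.val + j.val ≤ 4 →
      (⟨(i, j, true), hij⟩ : PosRoot) ∈ coreD6.K := fun i j hij h => by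
    refine Finset.mem_filter.mpr ⟨Finset.mem_univ _, ?_⟩
    rw [PosRoot.height_eq]
    simp only [if_true]
    omega
  refine mul_mem (mul_mem (mul_mem (mul_mem (mul_mem ?_ ?_) ?_) ?_) ?_) ?_ <;>
    exact rootElt_mem (hK _ _ _ (by decide)) _

theorem mem_range_false (i j : Fin 6) (h : i < j) (t : F) :
    coreCoord (1 + single i j t) 0 ∈ (coordHom (F := F)).range :=
  ⟨⟨rootElt ⟨(i, j, false), h⟩ t, rootElt_mem (Finset.mem_univ _) t⟩,
    matrixCoord_rootElt_false i j h t⟩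

theorem mem_range_true (i j : Fin 6) (h : i < j) (t : F) :
    coreCoord 1 (single i j t - single j i t) ∈ (coordHom (F := F)).range :=
  ⟨⟨rootElt ⟨(i, j, true), h⟩ t, rootElt_mem (Finset.mem_univ _) t⟩,
    matrixCoord_rootElt_true i j h t⟩

end Coordinates

section Coordinates

variable {F : Type*} [Field F]

open Matrix

/-! ### Surjectivity of the coordinate map, the torus and the central roots -/

namespace CoreGroup

/-- The element with given coordinates in the abelian normal subgroup. -/
def ofPS (p01 p02 p12 s00 s10 s11 s20 s21 s22 : F) : CoreGroup F :=
  { (1 : CoreGroup F) with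
    p01 := p01, p02 := p02, p12 := p12, s00 := s00, s10 := s10, s11 := s11, s20 := s20,
      s21 := s21, s22 := s22 }

/-- The element with given matrix `m`. -/
def ofM (m00 m01 m02 m10 m11 m12 m20 m21 m22 : F) : CoreGroup F :=
  { (1 : CoreGroup F) with
    m00 := m00, m01 := m01, m02 := m02, m10 := m10, m11 := m11, m12 := m12, m20 := m20,
      m21 := m21, m22 := m22 }

/-- The element with given unitriangular matrices. -/
def ofGK (g01 g12 g02 k01 k12 k02 : F) : CoreGroup F :=
  { (1 : CoreGroup F) with
    g01 := g01, g12 := g12, g02 := g02, k01 := k01, k12 := k12, k02 := k02 }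

theorem ofPS_mul (a b c d e f g h i a' b' c' d' e' f' g' h' i' : F) :
    ofPS a b c d e f g h i * ofPS a' b' c' d' e' f' g' h' i' =
      ofPS (a + a') (b + b') (c + c') (d + d') (e + e') (f + f') (g + g') (h + h') (i + i') := by
  ext <;> simp [ofPS, mul_def, mul, one_def]

theorem ofM_mul (a b c d e f g h i a' b' c' d' e' f' g' h' i' : F) :
    ofM a b c d e f g h i * ofM a' b' c' d' e' f' g' h' i' =
      ofM (a + a') (b + b') (c + c') (d + d') (e + e') (f + f') (g + g') (h + h') (i + i') := by
  ext <;> simp [ofM, mul_def, mul, one_def]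

theorem ofGK_mul (a b c d e f a' b' c' d' e' f' : F) :
    ofGK a b c d e f * ofGK a' b' c' d' e' f' =
      ofGK (a + a') (b + b') (c + c' + a * b') (d + d') (e + e') (f + f' + d * e') := by
  ext <;> simp [ofGK, mul_def, mul, one_def]

theorem eq_ofPS_mul (e : CoreGroup F) :
    e = ofPS e.p01 e.p02 e.p12 e.s00 e.s10 e.s11 e.s20 e.s21 e.s22 *
      (ofM e.m00 e.m01 e.m02 e.m10 e.m11 e.m12 e.m20 e.m21 e.m22 *
        ofGK e.g01 e.g12 e.g02 e.k01 e.k12 e.k02) := by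
  ext <;> simp [ofPS, ofM, ofGK, mul_def, mul, one_def]

end CoreGroup

open CoreGroup

theorem mem_range_of_eq_false (i j : Fin 6) (t : F) (e : CoreGroup F) (h : i < j)
    (he : coreCoord (1 + single i j t) 0 = e) : e ∈ (coordHom (F := F)).range :=
  he ▸ mem_range_false i j h t

theorem mem_range_of_eq_true (i j : Fin 6) (t : F) (e : CoreGroup F) (h : i < j)
    (he : coreCoord 1 (single i j t - single j i t) = e) : e ∈ (coordHom (F := F)).range :=
  he ▸ mem_range_true i j h t

theorem ofPS_mem_range (p01 p02 p12 s00 s10 s11 s20 s21 s22 : F) :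
    ofPS p01 p02 p12 s00 s10 s11 s20 s21 s22 ∈ (coordHom (F := F)).range := by
  have h : ofPS p01 p02 p12 s00 s10 s11 s20 s21 s22 =
      ofPS p01 0 0 0 0 0 0 0 0 * (ofPS 0 p02 0 0 0 0 0 0 0 * (ofPS 0 0 p12 0 0 0 0 0 0 * (
      ofPS 0 0 0 s00 0 0 0 0 0 * (ofPS 0 0 0 0 s10 0 0 0 0 * (ofPS 0 0 0 0 0 s11 0 0 0 * (
      ofPS 0 0 0 0 0 0 s20 0 0 * (ofPS 0 0 0 0 0 0 0 s21 0 * ofPS 0 0 0 0 0 0 0 0 s22))))))) := by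
    simp only [ofPS_mul, add_zero, zero_add]
  rw [h]
  refine mul_mem ?_ <| mul_mem ?_ <| mul_mem ?_ <| mul_mem ?_ <|
    mul_mem ?_ <| mul_mem ?_ <| mul_mem ?_ <| mul_mem ?_ ?_
  · exact mem_range_of_eq_true 4 5 (-p01) _ (by decide)
      (by simp [coreCoord, ofPS, one_def])
  · exact mem_range_of_eq_true 3 5 (-p02) _ (by decide)
      (by simp [coreCoord, ofPS, one_def])
  · exact mem_range_of_eq_true 3 4 (-p12) _ (by decide)
      (by simp [coreCoord, ofPS, one_def])
  · exact mem_range_of_eq_true 0 5 s00 _ (by decide)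
      (by simp [coreCoord, ofPS, one_def])
  · exact mem_range_of_eq_true 1 5 s10 _ (by decide)
      (by simp [coreCoord, ofPS, one_def])
  · exact mem_range_of_eq_true 1 4 s11 _ (by decide)
      (by simp [coreCoord, ofPS, one_def])
  · exact mem_range_of_eq_true 2 5 s20 _ (by decide)
      (by simp [coreCoord, ofPS, one_def])
  · exact mem_range_of_eq_true 2 4 s21 _ (by decide)
      (by simp [coreCoord, ofPS, one_def])
  · exact mem_range_of_eq_true 2 3 s22 _ (by decide)
      (by simp [coreCoord, ofPS, one_def])

theorem ofM_mem_range (m00 m01 m02 m10 m11 m12 m20 m21 m22 : F) :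
    ofM m00 m01 m02 m10 m11 m12 m20 m21 m22 ∈ (coordHom (F := F)).range := by
  have h : ofM m00 m01 m02 m10 m11 m12 m20 m21 m22 =
      ofM m00 0 0 0 0 0 0 0 0 * (ofM 0 m01 0 0 0 0 0 0 0 * (ofM 0 0 m02 0 0 0 0 0 0 * (
      ofM 0 0 0 m10 0 0 0 0 0 * (ofM 0 0 0 0 m11 0 0 0 0 * (ofM 0 0 0 0 0 m12 0 0 0 * (
      ofM 0 0 0 0 0 0 m20 0 0 * (ofM 0 0 0 0 0 0 0 m21 0 * ofM 0 0 0 0 0 0 0 0 m22))))))) := by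
    simp only [ofM_mul, add_zero, zero_add]
  rw [h]
  refine mul_mem ?_ <| mul_mem ?_ <| mul_mem ?_ <| mul_mem ?_ <|
    mul_mem ?_ <| mul_mem ?_ <| mul_mem ?_ <| mul_mem ?_ ?_
  · exact mem_range_of_eq_false 0 5 m00 _ (by decide)
      (by simp [coreCoord, ofM, one_def])
  · exact mem_range_of_eq_false 0 4 m01 _ (by decide)
      (by simp [coreCoord, ofM, one_def])
  · exact mem_range_of_eq_false 0 3 m02 _ (by decide)
      (by simp [coreCoord, ofM, one_def])
  · exact mem_range_of_eq_false 1 5 m10 _ (by decide)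
      (by simp [coreCoord, ofM, one_def])
  · exact mem_range_of_eq_false 1 4 m11 _ (by decide)
      (by simp [coreCoord, ofM, one_def])
  · exact mem_range_of_eq_false 1 3 m12 _ (by decide)
      (by simp [coreCoord, ofM, one_def])
  · exact mem_range_of_eq_false 2 5 m20 _ (by decide)
      (by simp [coreCoord, ofM, one_def])
  · exact mem_range_of_eq_false 2 4 m21 _ (by decide)
      (by simp [coreCoord, ofM, one_def])
  · exact mem_range_of_eq_false 2 3 m22 _ (by decide)
      (by simp [coreCoord, ofM, one_def])

theorem ofGK_mem_range (g01 g12 g02 k01 k12 k02 : F) :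
    ofGK g01 g12 g02 k01 k12 k02 ∈ (coordHom (F := F)).range := by
  -- The factors g12 and k12 precede g01 and k01, so that no cross terms arise in g02 and k02.
  have h : ofGK g01 g12 g02 k01 k12 k02 =
      ofGK 0 g12 0 0 0 0 * (ofGK g01 0 0 0 0 0 * (ofGK 0 0 g02 0 0 0 * (ofGK 0 0 0 0 k12 0 * (
      ofGK 0 0 0 k01 0 0 * ofGK 0 0 0 0 0 k02)))) := by
    simp only [ofGK_mul, add_zero, zero_add, mul_zero, zero_mul]
  rw [h]
  refine mul_mem ?_ <| mul_mem ?_ <| mul_mem ?_ <| mul_mem ?_ <| mul_mem ?_ ?_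
  · exact mem_range_of_eq_false 1 2 g12 _ (by decide)
      (by simp [coreCoord, ofGK, one_def])
  · exact mem_range_of_eq_false 0 1 g01 _ (by decide)
      (by simp [coreCoord, ofGK, one_def])
  · exact mem_range_of_eq_false 0 2 g02 _ (by decide)
      (by simp [coreCoord, ofGK, one_def])
  · exact mem_range_of_eq_false 3 4 (-k12) _ (by decide)
      (by simp [coreCoord, ofGK, one_def])
  · exact mem_range_of_eq_false 4 5 (-k01) _ (by decide)
      (by simp [coreCoord, ofGK, one_def])
  · exact mem_range_of_eq_false 3 5 (-k02) _ (by decide)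
      (by simp [coreCoord, ofGK, one_def])

theorem coordHom_surjective : Function.Surjective (coordHom (F := F)) := by
  rw [← MonoidHom.range_eq_top, eq_top_iff]
  intro e _
  rw [eq_ofPS_mul e]
  exact mul_mem (ofPS_mem_range ..) (mul_mem (ofM_mem_range ..) (ofGK_mem_range ..))

theorem coordHom_eq_one (u : rootSubgroup F coreD6.P)
    (h : (u : GL (Fin 6 ⊕ Fin 6) F) ∈ rootSubgroup F coreD6.K) : coordHom u = 1 := by
  have hle : rootSubgroup F coreD6.K ≤ (coordHom (F := F)).ker.map (Subgroup.subtype _) := by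
    rw [rootSubgroup, Subgroup.closure_le]
    rintro _ ⟨α, hα, t, rfl⟩
    exact ⟨⟨rootElt α t, rootElt_mem (coreD6.subset hα) t⟩, matrixCoord_rootElt_of_height hα t, rfl⟩
  obtain ⟨v, hv, hvu⟩ := hle h
  rw [← Subtype.ext hvu]
  exact hv

variable (F) in
/-- The quattern group in coordinates. -/
noncomputable def coordEquiv : QuatternGroup coreD6 F ≃* CoreGroup F :=
  MulEquiv.ofBijective (QuotientGroup.lift _ (coordHom (F := F)) fun u hu =>
    coordHom_eq_one u (Subgroup.mem_subgroupOf.mp hu)) <| by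
    constructor
    · rw [injective_iff_map_eq_one]
      intro g hg
      induction g using QuotientGroup.induction_on with
      | H u =>
        exact (QuotientGroup.eq_one_iff (N := (rootSubgroup F coreD6.K).subgroupOf _) u).mpr
          (Subgroup.mem_subgroupOf.mpr (mem_of_coordHom_eq_one u hg))
    · intro e
      obtain ⟨u, hu⟩ := coordHom_surjective e
      exact ⟨QuotientGroup.mk u, hu⟩

theorem coordEquiv_x (α : coreD6.P) (t : F) : coordEquiv F (QuatternGroup.x coreD6 α t) =
    matrixCoord (rootElt α.1 t : Matrix (Fin 6 ⊕ Fin 6) (Fin 6 ⊕ Fin 6) F) := rfl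

/-- The torus element which multiplies the three rows by `a * b * c`, `b * c` and `c` induces an
automorphism. -/
def torusHom (a b c : F) : CoreGroup F →* CoreGroup F where
  toFun e :=
    { e with
      g01 := a * e.g01
      g12 := b * e.g12
      g02 := a * b * e.g02
      m00 := a * b * c * e.m00
      m01 := a * b * c * e.m01
      m02 := a * b * c * e.m02
      m10 := b * c * e.m10
      m11 := b * c * e.m11
      m12 := b * c * e.m12
      m20 := c * e.m20
      m21 := c * e.m21
      m22 := c * e.m22
      s00 := a * b * c * e.s00
      s10 := b * c * e.s10
      s11 := b * c * e.s11
      s20 := c * e.s20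
      s21 := c * e.s21
      s22 := c * e.s22 }
  map_one' := by ext <;> simp [CoreGroup.one_def]
  map_mul' e f := by ext <;> simp only [CoreGroup.mul_def, CoreGroup.mul] <;> ring

theorem torusHom_torusHom (a b c a' b' c' : F) (e : CoreGroup F) :
    torusHom a b c (torusHom a' b' c' e) = torusHom (a * a') (b * b') (c * c') e := by
  ext <;> simp only [torusHom, MonoidHom.coe_mk, OneHom.coe_mk] <;> ring

theorem torusHom_one (e : CoreGroup F) : torusHom 1 1 1 e = e := by
  ext <;> simp [torusHom]

/-- The torus automorphism which multiplies the rows by `j₀`, `j₁` and `j₂`. -/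
def torusEquiv (j₀ j₁ j₂ : Fˣ) : CoreGroup F ≃* CoreGroup F where
  __ := torusHom (↑(j₀ / j₁)) (↑(j₁ / j₂)) (↑j₂ : F)
  invFun := torusHom (↑(j₀ / j₁)⁻¹) (↑(j₁ / j₂)⁻¹) (↑j₂⁻¹ : F)
  left_inv e := by
    change torusHom _ _ _ (torusHom _ _ _ e) = e
    rw [torusHom_torusHom, Units.inv_mul, Units.inv_mul, Units.inv_mul, torusHom_one]
  right_inv e := by
    change torusHom _ _ _ (torusHom _ _ _ e) = e
    rw [torusHom_torusHom, Units.mul_inv, Units.mul_inv, Units.mul_inv, torusHom_one]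

theorem torusEquiv_central (j₀ j₁ j₂ : Fˣ) (w x y z : F) :
    torusEquiv j₀ j₁ j₂ (CoreGroup.central w x y z) =
      CoreGroup.central (j₀ * w) (j₀ * x) (j₁ * y) (j₂ * z) := by
  have h : (↑(j₀ / j₁) : F) * ↑(j₁ / j₂) * ↑j₂ = j₀ := by
    rw [← Units.val_mul, ← Units.val_mul, div_mul_div_cancel, div_mul_cancel]
  have h' : (↑(j₁ / j₂) : F) * ↑j₂ = j₁ := by rw [← Units.val_mul, div_mul_cancel]
  change torusHom _ _ _ _ = _
  ext <;> simp only [torusHom, MonoidHom.coe_mk, OneHom.coe_mk, CoreGroup.central,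
    CoreGroup.one_def, mul_zero, h, h']

/-- The highest roots. -/
def coreRoot : Fin 4 → coreZ :=
  ![⟨⟨(0, 5, false), by decide⟩, by rw [coreZ_eq]; decide +kernel⟩,
    ⟨⟨(0, 5, true), by decide⟩, by rw [coreZ_eq]; decide +kernel⟩,
    ⟨⟨(1, 4, true), by decide⟩, by rw [coreZ_eq]; decide +kernel⟩,
    ⟨⟨(2, 3, true), by decide⟩, by rw [coreZ_eq]; decide +kernel⟩]

theorem coreRoot_surjective : Function.Surjective coreRoot := by
  rintro ⟨γ, hγ⟩
  have hγ' := hγ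
  rw [coreZ_eq] at hγ'
  have : γ ∈ coreList.drop 20 := hγ'
  simp only [coreList, List.drop_succ_cons, List.drop_zero, List.mem_cons, List.not_mem_nil,
    or_false] at this
  rcases this with rfl | rfl | rfl | rfl
  exacts [⟨0, rfl⟩, ⟨1, rfl⟩, ⟨2, rfl⟩, ⟨3, rfl⟩]

/-- The coordinates of the elements of the root subgroups of the highest roots. -/
theorem coordEquiv_coreRoot (t : F) :
    coordEquiv F (QuatternGroup.x coreD6 ⟨(coreRoot 0).1, Finset.mem_univ _⟩ t) =
      CoreGroup.central t 0 0 0 ∧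
    coordEquiv F (QuatternGroup.x coreD6 ⟨(coreRoot 1).1, Finset.mem_univ _⟩ t) =
      CoreGroup.central 0 t 0 0 ∧
    coordEquiv F (QuatternGroup.x coreD6 ⟨(coreRoot 2).1, Finset.mem_univ _⟩ t) =
      CoreGroup.central 0 0 t 0 ∧
    coordEquiv F (QuatternGroup.x coreD6 ⟨(coreRoot 3).1, Finset.mem_univ _⟩ t) =
      CoreGroup.central 0 0 0 t := by
  refine ⟨?_, ?_, ?_, ?_⟩ <;> rw [coordEquiv_x]
  · refine (matrixCoord_rootElt_false 0 5 (by decide) t).trans ?_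
    ext <;> simp [coreCoord, CoreGroup.central, CoreGroup.one_def]
  · refine (matrixCoord_rootElt_true 0 5 (by decide) t).trans ?_
    ext <;> simp [coreCoord, CoreGroup.central, CoreGroup.one_def]
  · refine (matrixCoord_rootElt_true 1 4 (by decide) t).trans ?_
    ext <;> simp [coreCoord, CoreGroup.central, CoreGroup.one_def]
  · refine (matrixCoord_rootElt_true 2 3 (by decide) t).trans ?_
    ext <;> simp [coreCoord, CoreGroup.central, CoreGroup.one_def]

end Coordinates

/-! ### Representatives of the orbits of quadratic forms -/

section Transversals

open StabLabel

variable {F : Type*} [Field F] {ψ : AddChar F ℂ}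

theorem AddChar.eq_of_forall_mul_eq [Finite F] (hψ : ψ ≠ 1) {c d : F}
    (h : ∀ t, ψ (c * t) = ψ (d * t)) : c = d :=
  sub_eq_zero.mp <| AddChar.eq_zero_of_forall_eq hψ _ _ h fun t => by ring

theorem Nat.card_stab_eq_one (q : TernaryForm F)
    (h : ∀ r s t, q.act r s t = q → r = 0 ∧ s = 0 ∧ t = 0) : Nat.card q.Stab = 1 := by
  rw [Nat.card_eq_one_iff_unique]
  refine ⟨⟨?_⟩, ⟨⟨(0, 0, 0), q.act_zero⟩⟩⟩
  rintro ⟨⟨r, s, t⟩, h1⟩ ⟨⟨r', s', t'⟩, h2⟩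
  obtain ⟨rfl, rfl, rfl⟩ := h _ _ _ h1
  obtain ⟨rfl, rfl, rfl⟩ := h _ _ _ h2
  rfl

theorem Nat.card_stab_eq {R : Type*} (q : TernaryForm F) (f : R → F × F × F)
    (hf : Function.Injective f)
    (h : ∀ r s t, q.act r s t = q ↔ ∃ x, f x = (r, s, t)) : Nat.card q.Stab = Nat.card R := by
  symm
  refine Nat.card_congr (Equiv.ofBijective (fun x => ⟨f x, (h _ _ _).mpr ⟨x, rfl⟩⟩) ⟨?_, ?_⟩)
  · intro x y hxy
    exact hf (Subtype.ext_iff.mp hxy)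
  · rintro ⟨⟨r, s, t⟩, h1⟩
    obtain ⟨x, hx⟩ := (h _ _ _).mp h1
    exact ⟨x, Subtype.ext hx⟩

/-- The labels in odd characteristic. -/
def oddLabel (a : Fˣ) : (F × Fˣ) ⊕ Fˣ ⊕ (F × F) → StabLabel F
  -- Since 2a ≠ 0, r and s remove u and v. Then t removes c if b ≠ 0, removes d if b = 0 ≠ c, and
  -- acts trivially if b = c = 0; only in the last case is there a nontrivial stabilizer, with
  -- characters e.
  | .inl (d, b) => ⟨⟨a, 0, 0, b, 0, d⟩, 0, 0, 0, by simp⟩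
  | .inr (.inl c) => ⟨⟨a, 0, 0, 0, c, 0⟩, 0, 0, 0, by simp⟩
  | .inr (.inr (d, e)) => ⟨⟨a, 0, 0, 0, 0, d⟩, 0, 0, e, by simp⟩

theorem card_stab_oddLabel [Finite F] (h2 : (2 : F) ≠ 0) (a : Fˣ) :
    (∀ ℓ, Nat.card (oddLabel a (.inl ℓ)).q.Stab = 1) ∧
    (∀ ℓ, Nat.card (oddLabel a (.inr (.inl ℓ))).q.Stab = 1) ∧
    (∀ ℓ, Nat.card (oddLabel a (.inr (.inr ℓ))).q.Stab = Nat.card F) := by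
  refine ⟨?_, ?_, ?_⟩
  · rintro ⟨d, b⟩
    refine Nat.card_stab_eq_one _ fun r s t h => ?_
    simp only [oddLabel, TernaryForm.act, TernaryForm.mk.injEq, zero_add, zero_mul, add_zero,
      mul_eq_zero, h2, a.ne_zero, false_or, true_and] at h
    obtain ⟨rfl, rfl, -, h3, -⟩ := h
    simpa [h2] using h3
  · rintro c
    refine Nat.card_stab_eq_one _ fun r s t h => ?_
    simp only [oddLabel, TernaryForm.act, TernaryForm.mk.injEq, zero_add, zero_mul, add_zero,
      mul_eq_zero, h2, a.ne_zero, false_or, true_and] at h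
    obtain ⟨rfl, rfl, -, -, h3⟩ := h
    simpa using h3
  · rintro ⟨d, e⟩
    refine Nat.card_stab_eq _ (fun t => (0, 0, t)) (fun x y h => by simpa using h) fun r s t => ?_
    simp only [oddLabel, TernaryForm.act, TernaryForm.mk.injEq, zero_add, zero_mul, add_zero,
      mul_eq_zero, h2, a.ne_zero, false_or, true_and, Prod.mk.injEq]
    constructor
    · rintro ⟨rfl, rfl, -⟩
      exact ⟨t, rfl, rfl, rfl⟩
    · rintro ⟨_, rfl, rfl, -⟩
      simp

theorem isTransversal_oddLabel [Fintype F] [DecidableEq F] (hψ : ψ ≠ 1) (h2 : (2 : F) ≠ 0)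
    (a : Fˣ) : IsTransversal ψ (a : F) (oddLabel a) where
  leading := by rintro (⟨d, b⟩ | c | ⟨d, e⟩) <;> rfl
  orbit ℓ m r s t h := by
    rcases ℓ with (⟨d, b⟩ | c | ⟨d, e⟩) <;> rcases m with (⟨d', b'⟩ | c' | ⟨d', e'⟩) <;>
      simp only [oddLabel, TernaryForm.act, TernaryForm.mk.injEq, zero_add, zero_mul, add_zero,
        mul_eq_zero, h2, a.ne_zero, false_or, true_and] at h ⊢ <;>
      obtain ⟨rfl, rfl, h3, h4, h5⟩ := h
    · have ht : t = 0 := by simpa [h2] using h4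
      subst ht
      exact ⟨by simpa using h3, by simpa using h5⟩
    · simp at h3
    · simp at h3
    · simp [eq_comm] at h3
    · simpa using h4
    · simp at h4
    · simp [eq_comm] at h3
    · simp [eq_comm] at h4
    · simpa using h5
  linear ℓ m h h' := by
    rcases ℓ with (⟨d, b⟩ | c | ⟨d, e⟩) <;> rcases m with (⟨d', b'⟩ | c' | ⟨d', e'⟩) <;>
      simp only [oddLabel, TernaryForm.mk.injEq, true_and, Units.ne_zero, (Units.ne_zero _).symm,
        false_and, and_false, Units.val_inj, and_true] at h
    · simp [h]
    · simp [h]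
    · subst h
      have : e = e' := AddChar.eq_of_forall_mul_eq hψ fun t => by
        simpa [oddLabel] using h' 0 0 t (by simp [oddLabel, TernaryForm.act])
      rw [this]
  sum_eq := by
    obtain ⟨h1, h3, h4⟩ := card_stab_oddLabel h2 a
    have hF : (Nat.card F : ℂ) ≠ 0 := by exact_mod_cast Nat.card_pos.ne'
    have hu : (Nat.card Fˣ : ℂ) = Nat.card F - 1 := by
      rw [Nat.card_units, Nat.cast_sub Nat.card_pos, Nat.cast_one]
    simp only [Fintype.sum_sum_type, h1, h3, h4, Finset.sum_const, Finset.card_univ, nsmul_eq_mul,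
      Fintype.card_eq_nat_card, Nat.card_prod, Nat.cast_mul, hu]
    -- The identity is q(q - 1) + (q - 1) + q²/q² = q².
    field_simp
    ring

/-- The elements `0` and `1` of a field. -/
def bit (β : ZMod 2) : F := if β = 0 then 0 else 1

theorem bit_eq (β : ZMod 2) : (bit β : F) = 0 ∨ (bit β : F) = 1 := by
  unfold bit
  split_ifs <;> simp

theorem bit_injective : Function.Injective (bit : ZMod 2 → F) := by
  have : ∀ x : ZMod 2, x = 0 ∨ x = 1 := by decide
  intro x y h
  rcases this x with rfl | rfl <;> rcases this y with rfl | rfl <;> simp_all [bit]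

theorem AddChar.bit_injective {τ : F} (hτ : ψ τ ≠ 1) {β β' : ZMod 2}
    (h : ψ (bit β * τ) = ψ (bit β' * τ)) : β = β' := by
  have : ∀ x : ZMod 2, x = 0 ∨ x = 1 := by decide
  rcases this β with rfl | rfl <;> rcases this β' with rfl | rfl <;> simp_all [bit]

/-- The labels in characteristic two. -/
def evenLabel (τ : F) (a : Fˣ) : (ZMod 2 × F × ZMod 2 × Fˣ) ⊕ (F × F × Fˣ) ⊕ F ⊕
    (F × ZMod 2 × ZMod 2 × Fˣ) → StabLabel F
  -- For u ≠ 0, t removes v and s removes c, and b is defined modulo a r² + u r. Scaling by u²/a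
  -- turns these values into y² + y, so 0 and τ represent the classes when ψ(τ) ≠ 1. The stabilizer
  -- is r ∈ {0, u/a}, and e₁ is chosen so that the value at u/a is ψ(ετ).
  | .inl (β, d, ε, u) =>
    ⟨⟨a, u, 0, u ^ 2 / a * (bit β * τ), 0, d⟩, bit ε * τ * (a / u), 0, 0, by simp⟩
  -- For u = 0, squares fill the field, so r removes b. If c ≠ 0, then t removes d, and in the
  -- stabilizer s is free and determines t.
  | .inr (.inl (v, e, c)) => ⟨⟨a, 0, v, 0, c, 0⟩, 0, e, 0, fun r s t r' s' t' h _ => by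
      have h := congrArg TernaryForm.b h
      have : r = 0 := by simpa [TernaryForm.act] using h
      rw [this, zero_mul, mul_zero]⟩
  -- With c = v = 0, the squares a s² remove d and t remains free.
  | .inr (.inr (.inl e)) => ⟨⟨a, 0, 0, 0, 0, 0⟩, 0, 0, e, by simp⟩
  -- With c = 0 ≠ v, d is an Artin–Schreier class modulo a s² + v s. The stabilizer is s ∈ {0, v/a}
  -- with t free, with characters ε and e.
  | .inr (.inr (.inr (e, β, ε, v))) => ⟨⟨a, 0, v, 0, 0, v ^ 2 / a * (bit β * τ)⟩,
      0, bit ε * τ * (a / v), e, fun r s t r' s' t' h _ => by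
      have h := congrArg TernaryForm.b h
      have : r = 0 := by simpa [TernaryForm.act] using h
      rw [this, zero_mul, mul_zero]⟩

theorem artinSchreier_eq_zero (h2 : (2 : F) = 0) (a u : Fˣ) (r : F) :
    (a : F) * r ^ 2 + u * r = 0 ↔ ∃ β, bit β * ((u : F) / a) = r := by
  have ha := a.ne_zero
  constructor
  · intro h
    have h3 : r * (a * r + u) = 0 := by linear_combination h
    rcases mul_eq_zero.mp h3 with h4 | h4
    · exact ⟨0, by simp [bit, h4]⟩
    · refine ⟨1, ?_⟩
      simp only [bit, one_ne_zero, if_false, one_mul]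
      field_simp
      linear_combination h4 - a * r * h2
  · rintro ⟨β, rfl⟩
    rcases bit_eq (F := F) β with h | h <;> rw [h]
    · simp
    · field_simp
      linear_combination u ^ 2 * h2

theorem card_stab_evenLabel [Finite F] (h2 : (2 : F) = 0) (τ : F) (a : Fˣ) :
    (∀ ℓ, Nat.card (evenLabel τ a (.inl ℓ)).q.Stab = 2) ∧
    (∀ ℓ, Nat.card (evenLabel τ a (.inr (.inl ℓ))).q.Stab = Nat.card F) ∧
    (∀ ℓ, Nat.card (evenLabel τ a (.inr (.inr (.inl ℓ)))).q.Stab = Nat.card F) ∧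
    (∀ ℓ, Nat.card (evenLabel τ a (.inr (.inr (.inr ℓ)))).q.Stab = 2 * Nat.card F) := by
  refine ⟨?_, ?_, ?_, ?_⟩
  · rintro ⟨β, d, ε, u⟩
    rw [Nat.card_stab_eq (R := ZMod 2) _ (fun β => (bit β * ((u : F) / a), 0, 0)), Nat.card_zmod]
    · intro x y h
      simpa [bit_injective.eq_iff] using h
    · intro r s t
      simp only [evenLabel, TernaryForm.act, TernaryForm.mk.injEq, h2, zero_mul, add_zero, zero_add,
        true_and, mul_eq_zero, Units.ne_zero, false_or, Prod.mk.injEq, add_assoc, add_eq_left,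
        artinSchreier_eq_zero h2]
      constructor
      · rintro ⟨rfl, ⟨β, hβ⟩, h4, -⟩
        refine ⟨β, hβ, ?_, rfl⟩
        simpa [eq_comm] using h4
      · rintro ⟨β, hβ, rfl, rfl⟩
        exact ⟨rfl, ⟨β, hβ⟩, by simp, by simp⟩
  · rintro ⟨v, e, c⟩
    refine Nat.card_stab_eq (R := F) _ (fun s => (0, s, -(a * s ^ 2 + v * s) / c)) (fun x y h => ?_)
      fun r s t => ?_
    · exact (Prod.mk.inj (Prod.mk.inj h).2).1
    · simp only [evenLabel, TernaryForm.act, TernaryForm.mk.injEq, h2, zero_mul, mul_zero, add_zero,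
        zero_add, true_and, mul_eq_zero, Units.ne_zero, false_or, Prod.mk.injEq, pow_eq_zero_iff,
        ne_eq, OfNat.ofNat_ne_zero, not_false_eq_true]
      have hc := c.ne_zero
      constructor
      · rintro ⟨rfl, -, h3⟩
        refine ⟨s, rfl, rfl, ?_⟩
        field_simp
        linear_combination -h3
      · rintro ⟨s, rfl, rfl, rfl⟩
        refine ⟨rfl, by simp, ?_⟩
        field_simp
        ring
  · intro e
    refine Nat.card_stab_eq (R := F) _ (fun t => (0, 0, t)) (fun x y h => by simpa using h)
      fun r s t => ?_
    simp only [evenLabel, TernaryForm.act, TernaryForm.mk.injEq, h2, zero_mul, mul_zero, add_zero,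
      zero_add, true_and, mul_eq_zero, Units.ne_zero, false_or, Prod.mk.injEq, pow_eq_zero_iff,
      ne_eq, OfNat.ofNat_ne_zero, not_false_eq_true]
    constructor
    · rintro ⟨rfl, rfl⟩
      exact ⟨t, rfl, rfl, rfl⟩
    · rintro ⟨_, rfl, rfl, -⟩
      exact ⟨rfl, rfl⟩
  · rintro ⟨e, β, ε, v⟩
    rw [Nat.card_stab_eq (R := ZMod 2 × F) _ (fun x => (0, bit x.1 * ((v : F) / a), x.2)),
      Nat.card_prod, Nat.card_zmod]
    · rintro ⟨x, x'⟩ ⟨y, y'⟩ h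
      simpa [bit_injective.eq_iff] using h
    · intro r s t
      simp only [evenLabel, TernaryForm.act, TernaryForm.mk.injEq, h2, zero_mul, mul_zero, add_zero,
        zero_add, true_and, mul_eq_zero, Units.ne_zero, false_or, Prod.mk.injEq, add_assoc,
        add_eq_left, artinSchreier_eq_zero h2, pow_eq_zero_iff, ne_eq, OfNat.ofNat_ne_zero,
        not_false_eq_true]
      constructor
      · rintro ⟨rfl, -, ⟨β, hβ⟩⟩
        exact ⟨(β, t), rfl, hβ, rfl⟩
      · rintro ⟨⟨β, t⟩, rfl, hβ, rfl⟩
        exact ⟨rfl, rfl, β, hβ⟩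

/-- The additive character is trivial on the image of the Artin–Schreier map. -/
theorem AddChar.bit_eq_of_artinSchreier (h2 : (2 : F) = 0) (hψ2 : ∀ x, ψ (x ^ 2) = ψ x) {τ : F}
    (hτ : ψ τ ≠ 1) (a u : Fˣ) (r : F) {β β' : ZMod 2}
    (h : (u : F) ^ 2 / a * (bit β * τ) + a * r ^ 2 + u * r = u ^ 2 / a * (bit β' * τ)) :
    β = β' := by
  have ha := a.ne_zero
  have hu := u.ne_zero
  apply AddChar.bit_injective hτ
  have h3 : bit β' * τ = bit β * τ + ((a * r / u) ^ 2 + a * r / u) := by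
    field_simp at h ⊢
    linear_combination -h
  rw [h3, AddChar.map_add_eq_mul, AddChar.map_add_eq_mul, hψ2, ← AddChar.map_add_eq_mul ψ (_ / _),
    ← two_mul, h2, zero_mul, AddChar.map_zero_eq_one, mul_one]

theorem isTransversal_evenLabel [Fintype F] [DecidableEq F] (hψ : ψ ≠ 1) (h2 : (2 : F) = 0)
    (hψ2 : ∀ x, ψ (x ^ 2) = ψ x) {τ : F} (hτ : ψ τ ≠ 1) (a : Fˣ) :
    IsTransversal ψ (a : F) (evenLabel τ a) where
  leading := by rintro (⟨β, d, ε, u⟩ | ⟨v, e, c⟩ | e | ⟨e, β, ε, v⟩) <;> rfl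
  orbit ℓ m r s t h := by
    rcases ℓ with (⟨β, d, ε, u⟩ | ⟨v, e, c⟩ | e | ⟨e, β, ε, v⟩) <;>
      rcases m with (⟨β', d', ε', u'⟩ | ⟨v', e', c'⟩ | e' | ⟨e', β', ε', v'⟩) <;>
      simp only [evenLabel, TernaryForm.act, TernaryForm.mk.injEq, h2, zero_mul, mul_zero, add_zero,
        zero_add, true_and, mul_eq_zero, Units.ne_zero, (Units.ne_zero _).symm, false_or,
        pow_eq_zero_iff, ne_eq, OfNat.ofNat_ne_zero, not_false_eq_true, false_and, and_false,
        Units.val_inj] at h ⊢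
    · obtain ⟨rfl, rfl, hb, hc, hd⟩ := h
      have hs : s = 0 := by simpa using hc
      subst hs
      rw [AddChar.bit_eq_of_artinSchreier h2 hψ2 hτ a u r hb]
      simpa using hd
    · obtain ⟨rfl, rfl, hc, -⟩ := h
      simpa [Units.val_inj] using hc
    · obtain ⟨rfl, rfl, hc, -⟩ := h
      simp at hc
    · obtain ⟨rfl, rfl, hc, -⟩ := h
      simp at hc
    · obtain ⟨-, rfl, hc, -⟩ := h
      simp [eq_comm] at hc
    · obtain ⟨rfl, -, -, hd⟩ := h
      rw [AddChar.bit_eq_of_artinSchreier h2 hψ2 hτ a v s hd]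
      simp
  linear ℓ m h h' := by
    have ha := a.ne_zero
    rcases ℓ with (⟨β, d, ε, u⟩ | ⟨v, e, c⟩ | e | ⟨e, β, ε, v⟩) <;>
      rcases m with (⟨β', d', ε', u'⟩ | ⟨v', e', c'⟩ | e' | ⟨e', β', ε', v'⟩) <;>
      simp only [evenLabel, TernaryForm.mk.injEq, true_and, Units.ne_zero, (Units.ne_zero _).symm,
        false_and, and_false, Units.val_inj, and_true] at h
    · obtain ⟨rfl, hb, rfl⟩ := h
      have hβ : β = β' := AddChar.bit_eq_of_artinSchreier h2 hψ2 hτ a u 0 (by simpa using hb)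
      have hε : ε = ε' := by
        have hu := u.ne_zero
        have h3 := h' ((u : F) / a) 0 0 (by
          have := (artinSchreier_eq_zero h2 a u ((u : F) / a)).mpr ⟨1, by simp [bit]⟩
          simp [evenLabel, TernaryForm.act, h2, add_assoc, this])
        apply AddChar.bit_injective hτ
        simp only [evenLabel, zero_mul, add_zero] at h3
        convert h3 using 2 <;> field_simp
      rw [hβ, hε]
    · obtain ⟨rfl, rfl⟩ := h
      have : e = e' := AddChar.eq_of_forall_mul_eq hψ fun s => by
        have hc := c.ne_zero
        have h3 := h' 0 s (-(a * s ^ 2 + v * s) / c) (by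
          simp only [evenLabel, TernaryForm.act, h2, TernaryForm.mk.injEq]
          refine ⟨trivial, by ring, by ring, by ring, by ring, ?_⟩
          field_simp
          ring)
        simpa [evenLabel] using h3
      rw [this]
    · have : e = e' := AddChar.eq_of_forall_mul_eq hψ fun t => by
        simpa [evenLabel] using h' 0 0 t (by simp [evenLabel, TernaryForm.act])
      rw [this]
    · obtain ⟨rfl, hd⟩ := h
      have hβ : β = β' := AddChar.bit_eq_of_artinSchreier h2 hψ2 hτ a v 0 (by simpa using hd)
      have he : e = e' := AddChar.eq_of_forall_mul_eq hψ fun t => by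
        simpa [evenLabel] using h' 0 0 t (by simp [evenLabel, TernaryForm.act])
      have hε : ε = ε' := by
        have hv := v.ne_zero
        have h3 := h' 0 ((v : F) / a) 0 (by
          have := (artinSchreier_eq_zero h2 a v ((v : F) / a)).mpr ⟨1, by simp [bit]⟩
          simp [evenLabel, TernaryForm.act, h2, add_assoc, this])
        apply AddChar.bit_injective hτ
        simp only [evenLabel, mul_zero, zero_add, add_zero] at h3
        convert h3 using 2 <;> field_simp
      rw [hβ, he, hε]
  sum_eq := by
    obtain ⟨h1, h3, h4, h5⟩ := card_stab_evenLabel h2 τ a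
    have hF : (Nat.card F : ℂ) ≠ 0 := by exact_mod_cast Nat.card_pos.ne'
    have hu : (Nat.card Fˣ : ℂ) = Nat.card F - 1 := by
      rw [Nat.card_units, Nat.cast_sub Nat.card_pos, Nat.cast_one]
    simp only [Fintype.sum_sum_type, h1, h3, h4, h5, Finset.sum_const, Finset.card_univ,
      nsmul_eq_mul, Fintype.card_eq_nat_card, Nat.card_prod, Nat.cast_mul, hu, Nat.card_zmod,
      Nat.cast_ofNat]
    field_simp
    ring

end Transversals

/-! ### The families of characters of the quattern group -/

section Families

open CoreGroup StabLabel

theorem Irr.comp_mulEquiv {G H : Type*} [Group G] [Group H] (e : G ≃* H) {χ : H → ℂ}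
    (h : χ ∈ Irr H) : χ ∘ e ∈ Irr G := by
  obtain ⟨n, ρ, hρ, rfl⟩ := h
  let σ : Representation ℂ G (Fin n → ℂ) := ρ.comp e.toMonoidHom
  refine ⟨n, σ, ?_, rfl⟩
  let f : Subrepresentation ρ ≃o Subrepresentation σ :=
    { toFun := fun W => ⟨W.toSubmodule, fun g _ hv => W.apply_mem_toSubmodule (e g) hv⟩
      invFun := fun W => ⟨W.toSubmodule, fun g v hv => by
        have := W.apply_mem_toSubmodule (e.symm g) hv
        change ρ (e (e.symm g)) v ∈ _ at this
        rwa [e.apply_symm_apply] at this⟩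
      left_inv := fun _ => rfl
      right_inv := fun _ => rfl
      map_rel_iff' := Iff.rfl }
  exact f.isSimpleOrder_iff.mp hρ

theorem AddChar.exists_eq_mul {F : Type*} [Field F] [Finite F] {ψ : AddChar F ℂ} (hψ : ψ ≠ 1)
    (φ : AddChar F ℂ) : ∃ a, ∀ t, φ t = ψ (a * t) := by
  have := Fintype.ofFinite F
  have hinj : Function.Injective fun a => AddChar.mulShift ψ a := fun a b h =>
    AddChar.eq_of_forall_mul_eq hψ fun t => DFunLike.congr_fun h t
  obtain ⟨a, ha⟩ := ((Fintype.bijective_iff_injective_and_card _).mpr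
    ⟨hinj, AddChar.card_eq.symm⟩).2 φ
  exact ⟨a, fun t => (DFunLike.congr_fun ha t).symm⟩

variable {F : Type*} [Field F] [Finite F] {ψ : AddChar F ℂ} {L : Type*}

/-- The coordinates in which the character of the center with parameters `a` is normalized. -/
noncomputable def normalizedEquiv (a : coreZ → Fˣ) : QuatternGroup coreD6 F ≃* CoreGroup F :=
  (coordEquiv F).trans (torusEquiv (a (coreRoot 1)) (a (coreRoot 2)) (a (coreRoot 3)))

omit [Finite F] in
theorem normalizedEquiv_symm_central (a : coreZ → Fˣ) (w x y z : F) :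
    (normalizedEquiv a).symm (central (a (coreRoot 1) * w) (a (coreRoot 1) * x)
      (a (coreRoot 2) * y) (a (coreRoot 3) * z)) =
    QuatternGroup.x coreD6 ⟨(coreRoot 0).1, Finset.mem_univ _⟩ w *
    QuatternGroup.x coreD6 ⟨(coreRoot 1).1, Finset.mem_univ _⟩ x *
    QuatternGroup.x coreD6 ⟨(coreRoot 2).1, Finset.mem_univ _⟩ y *
    QuatternGroup.x coreD6 ⟨(coreRoot 3).1, Finset.mem_univ _⟩ z := by
  rw [MulEquiv.symm_apply_eq]
  obtain ⟨h0, -, -, -⟩ := coordEquiv_coreRoot w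
  obtain ⟨-, h1, -, -⟩ := coordEquiv_coreRoot x
  obtain ⟨-, -, h2, -⟩ := coordEquiv_coreRoot y
  obtain ⟨-, -, -, h3⟩ := coordEquiv_coreRoot z
  have mul_eq : ∀ {g h : QuatternGroup coreD6 F} {u v : CoreGroup F}, coordEquiv F g = u →
      coordEquiv F h = v → coordEquiv F (g * h) = u * v := by
    rintro g h _ _ rfl rfl
    exact map_mul (coordEquiv F) g h
  have e := mul_eq (mul_eq (mul_eq h0 h1) h2) h3
  rw [central_mul_central, central_mul_central, central_mul_central] at e
  refine Eq.symm ((congrArg (torusEquiv _ _ _) e).trans ?_)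
  rw [torusEquiv_central]
  simp

/-- The parameter `a₂₁ / a₂₂`. -/
def leadingCoeff (a : coreZ → Fˣ) : Fˣ := a (coreRoot 0) / a (coreRoot 1)

/-- The character with label `(ℓ, a)`. -/
noncomputable def coreChar (ψ : AddChar F ℂ) (Λ : Fˣ → L → StabLabel F) (ℓ : L) (a : coreZ → Fˣ) :
    QuatternGroup coreD6 F → ℂ :=
  ((Λ (leadingCoeff a) ℓ).linearDatum ψ).indChar ∘ normalizedEquiv a

theorem coreChar_one (Λ : Fˣ → L → StabLabel F) (ℓ : L) (a : coreZ → Fˣ) :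
    coreChar ψ Λ ℓ a 1 = (Nat.card F : ℂ) ^ 9 / Nat.card (Λ (leadingCoeff a) ℓ).q.Stab := by
  rw [coreChar, Function.comp_apply, map_one, indChar_one]

theorem coreChar_one_ne_zero (Λ : Fˣ → L → StabLabel F) (ℓ : L) (a : coreZ → Fˣ) :
    coreChar ψ Λ ℓ a 1 ≠ 0 := by
  have : Nonempty (Λ (leadingCoeff a) ℓ).q.Stab := ⟨⟨(0, 0, 0), TernaryForm.act_zero _⟩⟩
  rw [coreChar_one]
  exact div_ne_zero (pow_ne_zero _ (by exact_mod_cast Nat.card_pos.ne'))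
    (by exact_mod_cast Nat.card_pos.ne')

variable [Fintype L] {Λ : Fˣ → L → StabLabel F}

theorem coreChar_x (hΛ : ∀ a : Fˣ, IsTransversal ψ (a : F) (Λ a)) (ℓ : L) (a : coreZ → Fˣ)
    (γ : coreZ) (t : F) :
    coreChar ψ Λ ℓ a (QuatternGroup.x coreD6 ⟨γ.1, Finset.mem_univ _⟩ t) =
      coreChar ψ Λ ℓ a 1 * ψ (a γ * t) := by
  have key : ∀ w x y z : F, coreChar ψ Λ ℓ a ((coordEquiv F).symm (central w x y z)) =
      coreChar ψ Λ ℓ a 1 * ψ (a (coreRoot 0) * w + a (coreRoot 1) * x + a (coreRoot 2) * y +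
        a (coreRoot 3) * z) := by
    intro w x y z
    simp only [coreChar, Function.comp_apply, map_one]
    rw [normalizedEquiv, MulEquiv.trans_apply, MulEquiv.apply_symm_apply, torusEquiv_central,
      indChar_central, (hΛ _).leading]
    have h : (leadingCoeff a : F) * a (coreRoot 1) = a (coreRoot 0) := by
      rw [← Units.val_mul, leadingCoeff, div_mul_cancel]
    congr 2
    linear_combination w * h
  obtain ⟨h0, h1, h2, h3⟩ := coordEquiv_coreRoot t
  obtain ⟨i, rfl⟩ := coreRoot_surjective γ
  fin_cases i
  · simpa [← h0] using key t 0 0 0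
  · simpa [← h1] using key 0 t 0 0
  · simpa [← h2] using key 0 0 t 0
  · simpa [← h3] using key 0 0 0 t

theorem coreChar_injective (hψ : ψ ≠ 1) (hΛ : ∀ a : Fˣ, IsTransversal ψ (a : F) (Λ a)) :
    Function.Injective fun x : L × (coreZ → Fˣ) => coreChar ψ Λ x.1 x.2 := by
  rintro ⟨ℓ, a⟩ ⟨m, b⟩ h
  change coreChar ψ Λ ℓ a = coreChar ψ Λ m b at h
  have hab : a = b := by
    ext γ
    refine AddChar.eq_of_forall_mul_eq hψ fun t => ?_
    have h1 := coreChar_x hΛ ℓ a γ t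
    rw [h, coreChar_x hΛ m b γ t] at h1
    exact (mul_left_cancel₀ (coreChar_one_ne_zero Λ m b) h1).symm
  subst hab
  refine Prod.ext ((hΛ (leadingCoeff a)).injective hψ ?_) rfl
  exact (normalizedEquiv a).surjective.injective_comp_right h

omit [Finite F] in
theorem mem_center_coreRoot (γ : coreZ) (t : F) :
    QuatternGroup.x coreD6 ⟨γ.1, Finset.mem_univ _⟩ t ∈
      Subgroup.center (QuatternGroup coreD6 F) := by
  have key : ∀ (g : QuatternGroup coreD6 F) (w x y z : F), coordEquiv F g = central w x y z →
      g ∈ Subgroup.center (QuatternGroup coreD6 F) := by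
    intro g w x y z h
    rw [Subgroup.mem_center_iff]
    intro k
    apply (coordEquiv F).injective
    rw [map_mul, map_mul, h, central_mul]
  obtain ⟨h0, h1, h2, h3⟩ := coordEquiv_coreRoot t
  obtain ⟨i, rfl⟩ := coreRoot_surjective γ
  fin_cases i
  exacts [key _ _ _ _ _ h0, key _ _ _ _ _ h1, key _ _ _ _ _ h2, key _ _ _ _ _ h3]

omit [Finite F] in
theorem QuatternGroup.x_add {Q : Quattern} (α : Q.P) (s t : F) :
    QuatternGroup.x Q α (s + t) = QuatternGroup.x Q α s * QuatternGroup.x Q α t := by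
  have : rootElt α.1 (s + t) = rootElt α.1 s * rootElt α.1 t := by
    ext1
    change 1 + (s + t) • rootVector F α.1 =
      (1 + s • rootVector F α.1) * (1 + t • rootVector F α.1)
    simp [add_mul, mul_add, rootVector_mul_self, add_smul, add_assoc]
  simp only [QuatternGroup.x, this]
  rfl

omit [Finite F] in
theorem QuatternGroup.x_zero {Q : Quattern} (α : Q.P) : QuatternGroup.x Q α (0 : F) = 1 := by
  have := QuatternGroup.x_add (F := F) α 0 0
  rwa [add_zero, left_eq_mul] at this

theorem range_coreChar (hψ : ψ ≠ 1) (hΛ : ∀ a : Fˣ, IsTransversal ψ (a : F) (Λ a)) :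
    Set.range (fun x : L × (coreZ → Fˣ) => coreChar ψ Λ x.1 x.2) =
      IrrCentral coreD6 coreZ F := by
  have : Finite (QuatternGroup coreD6 F) := Finite.of_equiv _ (coordEquiv F).symm.toEquiv
  have := Fintype.ofFinite (QuatternGroup coreD6 F)
  ext χ
  constructor
  · rintro ⟨⟨ℓ, a⟩, rfl⟩
    refine ⟨Irr.comp_mulEquiv _ (StabLabel.indChar_mem_Irr _ hψ), fun α hα => ?_⟩
    by_contra! h
    refine (a ⟨α.1, hα⟩).ne_zero (AddChar.eq_zero_of_forall_mul hψ fun t => ?_)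
    have h1 := coreChar_x hΛ ℓ a ⟨α.1, hα⟩ t
    exact mul_left_cancel₀ (coreChar_one_ne_zero Λ ℓ a)
      (h1.symm.trans ((h t).trans (mul_one _).symm))
  · rintro ⟨hχ, hZ⟩
    obtain ⟨hχ1, c, hc⟩ := exists_centralChar hχ
    let xc : coreZ → F → Subgroup.center (QuatternGroup coreD6 F) := fun γ t =>
      ⟨_, mem_center_coreRoot γ t⟩
    let φ : coreZ → AddChar F ℂ := fun γ =>
      { toFun := fun t => c (xc γ t)
        map_zero_eq_one' := by
          rw [show xc γ 0 = 1 from Subtype.ext (QuatternGroup.x_zero _), map_one]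
        map_add_eq_mul' := fun s t => by
          rw [← map_mul]
          exact congrArg c (Subtype.ext (QuatternGroup.x_add _ s t)) }
    have hφ : ∀ γ, ∃ a : Fˣ, ∀ t, c (xc γ t) = ψ (a * t) := by
      intro γ
      obtain ⟨a, ha⟩ := AddChar.exists_eq_mul hψ (φ γ)
      have ha0 : a ≠ 0 := by
        rintro rfl
        obtain ⟨t, ht⟩ := hZ ⟨γ.1, Finset.mem_univ _⟩ γ.2
        apply ht
        have h1 := hc (xc γ t) 1
        have h2 : c (xc γ t) = 1 := by
          refine (ha t).trans ?_
          rw [zero_mul, AddChar.map_zero_eq_one]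
        rwa [h2, one_mul, mul_one] at h1
      exact ⟨Units.mk0 a ha0, ha⟩
    choose a ha using hφ
    have hcent : ∀ w x y z : F, χ ((normalizedEquiv a).symm (central w x y z)) =
        χ 1 * ψ (x + y + z + leadingCoeff a * w) := by
      intro w x y z
      have h1 := (a (coreRoot 1)).ne_zero
      have h2 := (a (coreRoot 2)).ne_zero
      have h3 := (a (coreRoot 3)).ne_zero
      have h4 := normalizedEquiv_symm_central a (w / a (coreRoot 1)) (x / a (coreRoot 1))
        (y / a (coreRoot 2)) (z / a (coreRoot 3))
      rw [mul_div_cancel₀ _ h1, mul_div_cancel₀ _ h1, mul_div_cancel₀ _ h2,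
        mul_div_cancel₀ _ h3] at h4
      have h5 := hc (xc (coreRoot 0) (w / a (coreRoot 1)) * xc (coreRoot 1) (x / a (coreRoot 1)) *
        xc (coreRoot 2) (y / a (coreRoot 2)) * xc (coreRoot 3) (z / a (coreRoot 3))) 1
      rw [map_mul, map_mul, map_mul, ha, ha, ha, ha, ← AddChar.map_add_eq_mul,
        ← AddChar.map_add_eq_mul, ← AddChar.map_add_eq_mul, mul_one] at h5
      rw [h4]
      refine h5.trans ?_
      rw [mul_comm]
      congr 2
      rw [leadingCoeff, Units.val_div_eq_div_val]
      field_simp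
      ring
    obtain ⟨ℓ, hℓ⟩ := (hΛ (leadingCoeff a)).exists_eq hψ
      (Irr.comp_mulEquiv (normalizedEquiv a).symm hχ) (fun w x y z => by
        simpa using hcent w x y z)
    refine ⟨(ℓ, a), ?_⟩
    change coreChar ψ Λ ℓ a = χ
    rw [coreChar, ← hℓ]
    ext g
    simp

/-- The additive character `phi p` as an `AddChar`. -/
noncomputable def phiChar (p : ℕ) [NeZero p] (F : Type*) [Field F] [Algebra (ZMod p) F] :
    AddChar F ℂ :=
  (ZMod.stdAddChar (N := p)).compAddMonoidHom (Algebra.trace (ZMod p) F).toAddMonoidHom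

theorem phiChar_apply (p : ℕ) [NeZero p] (F : Type*) [Field F] [Algebra (ZMod p) F] (t : F) :
    phiChar p F t = phi p t := rfl

theorem phiChar_ne_one (p : ℕ) [Fact p.Prime] (F : Type*) [Field F] [Finite F]
    [Algebra (ZMod p) F] : phiChar p F ≠ 1 := by
  obtain ⟨t, ht⟩ := Algebra.trace_surjective (ZMod p) F 1
  intro h
  have h1 : ZMod.stdAddChar (Algebra.trace (ZMod p) F t) = 1 := DFunLike.congr_fun h t
  rw [ht, ← AddChar.map_zero_eq_one (ZMod.stdAddChar (N := p))] at h1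
  exact one_ne_zero (ZMod.injective_stdAddChar h1)

theorem phiChar_sq (F : Type*) [Field F] [Finite F] [Algebra (ZMod 2) F] (t : F) :
    phiChar 2 F (t ^ 2) = phiChar 2 F t := by
  have := Fintype.ofFinite F
  have h := Algebra.trace_eq_of_algEquiv (FiniteField.frobeniusAlgEquivOfAlgebraic (ZMod 2) F) t
  have h2 : (FiniteField.frobeniusAlgEquivOfAlgebraic (ZMod 2) F) t = t ^ 2 := by
    simp
  rw [h2] at h
  exact congrArg (ZMod.stdAddChar (N := 2)) h

theorem isFamily_coreChar {p : ℕ} [Fact p.Prime] [Algebra (ZMod p) F]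
    (hΛ : ∀ a : Fˣ, IsTransversal (phiChar p F) (a : F) (Λ a)) {M : Type*} (i : M → L)
    (hi : Function.Injective i) (d : ℕ) (hd : ∀ a m, Nat.card (Λ a (i m)).q.Stab = d) (N : ℕ)
    (hN : N = Nat.card M * (Nat.card F - 1) ^ 4) (D : ℂ) (hD : D = (Nat.card F : ℂ) ^ 9 / d) :
    IsFamily p F M N D (Set.range fun x : M × (coreZ → Fˣ) =>
      coreChar (phiChar p F) Λ (i x.1) x.2) := by
  have hinj : Function.Injective fun x : M × (coreZ → Fˣ) =>
      coreChar (phiChar p F) Λ (i x.1) x.2 := fun x y h => by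
    have := coreChar_injective (phiChar_ne_one p F) hΛ (a₁ := (i x.1, x.2)) (a₂ := (i y.1, y.2)) h
    exact Prod.ext (hi (Prod.mk.inj this).1) (Prod.mk.inj this).2
  have hdeg : ∀ m a, coreChar (phiChar p F) Λ (i m) a 1 = D := fun m a => by
    rw [coreChar_one, hd, hD]
  refine ⟨?_, ?_, _, hinj, rfl, fun m a γ t => ?_⟩
  · have hZ : Nat.card coreZ = 4 := by
      rw [Nat.card_eq_fintype_card, Fintype.card_coe]
      exact coreD6_form.1
    rw [← Set.image_univ, Set.ncard_image_of_injective _ hinj, Set.ncard_univ, Nat.card_prod,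
      Nat.card_fun, Nat.card_units, hZ, hN]
  · rintro _ ⟨⟨m, a⟩, rfl⟩
    exact hdeg m a
  · rw [coreChar_x hΛ, hdeg, phiChar_apply]

theorem disjoint_range_coreChar (hψ : ψ ≠ 1) (hΛ : ∀ a : Fˣ, IsTransversal ψ (a : F) (Λ a))
    {M M' : Type*} (i : M → L) (i' : M' → L) (h : ∀ m m', i m ≠ i' m') :
    Disjoint (Set.range fun x : M × (coreZ → Fˣ) => coreChar ψ Λ (i x.1) x.2)
      (Set.range fun x : M' × (coreZ → Fˣ) => coreChar ψ Λ (i' x.1) x.2) := by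
  rw [Set.disjoint_left]
  rintro _ ⟨⟨m, a⟩, rfl⟩ ⟨⟨m', a'⟩, h'⟩
  have := coreChar_injective hψ hΛ (a₁ := (i' m', a')) (a₂ := (i m, a)) h'
  exact h m m' (Prod.mk.inj this).1.symm

end Families

theorem proposition5p3 (p : ℕ) [Fact p.Prime] (F : Type*) [Field F] [Finite F]
    [Algebra (ZMod p) F] (q : ℕ) (hq : q = Nat.card F) :
    (p ≠ 2 → ∃ 𝓕₁ 𝓕₂ 𝓕₃ : Set (QuatternGroup coreD6 F → ℂ),
      IrrCentral coreD6 coreZ F = 𝓕₁ ∪ 𝓕₂ ∪ 𝓕₃ ∧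
      Disjoint 𝓕₁ 𝓕₂ ∧ Disjoint 𝓕₁ 𝓕₃ ∧ Disjoint 𝓕₂ 𝓕₃ ∧
      IsFamily p F (F × Fˣ) (q * (q - 1) ^ 5) ((q : ℂ) ^ 9) 𝓕₁ ∧
      IsFamily p F Fˣ ((q - 1) ^ 5) ((q : ℂ) ^ 9) 𝓕₂ ∧
      IsFamily p F (F × F) (q ^ 2 * (q - 1) ^ 4) ((q : ℂ) ^ 8) 𝓕₃) ∧
    (p = 2 → ∃ 𝓕₁ 𝓕₂ 𝓕₃ 𝓕₄ : Set (QuatternGroup coreD6 F → ℂ),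
      IrrCentral coreD6 coreZ F = 𝓕₁ ∪ 𝓕₂ ∪ 𝓕₃ ∪ 𝓕₄ ∧
      Disjoint 𝓕₁ 𝓕₂ ∧ Disjoint 𝓕₁ 𝓕₃ ∧ Disjoint 𝓕₁ 𝓕₄ ∧
      Disjoint 𝓕₂ 𝓕₃ ∧ Disjoint 𝓕₂ 𝓕₄ ∧ Disjoint 𝓕₃ 𝓕₄ ∧
      IsFamily p F (ZMod 2 × F × ZMod 2 × Fˣ) (4 * q * (q - 1) ^ 5) ((q : ℂ) ^ 9 / 2) 𝓕₁ ∧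
      IsFamily p F (F × F × Fˣ) (q ^ 2 * (q - 1) ^ 5) ((q : ℂ) ^ 8) 𝓕₂ ∧
      IsFamily p F F (q * (q - 1) ^ 4) ((q : ℂ) ^ 8) 𝓕₃ ∧
      IsFamily p F (F × ZMod 2 × ZMod 2 × Fˣ) (4 * q * (q - 1) ^ 5) ((q : ℂ) ^ 8 / 2) 𝓕₄) := by
  classical
  have := Fintype.ofFinite F
  have hψ := phiChar_ne_one p F
  have hF : (Nat.card F : ℂ) ≠ 0 := by exact_mod_cast Nat.card_pos.ne'
  have hchar : CharP F p := charP_of_injective_algebraMap (algebraMap (ZMod p) F).injective p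
  subst hq
  constructor
  · intro hp
    have h2 : (2 : F) ≠ 0 := by
      intro h
      have h3 : ((2 : ℕ) : F) = 0 := by exact_mod_cast h
      rw [CharP.cast_eq_zero_iff F p] at h3
      exact hp ((Nat.prime_dvd_prime_iff_eq Fact.out Nat.prime_two).mp h3)
    have hΛ : ∀ a : Fˣ, StabLabel.IsTransversal (phiChar p F) (a : F) (oddLabel a) :=
      isTransversal_oddLabel hψ h2
    have hd := card_stab_oddLabel h2
    refine ⟨_, _, _, ?_,
      disjoint_range_coreChar hψ hΛ Sum.inl (fun m => Sum.inr (Sum.inl m)) (by simp),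
      disjoint_range_coreChar hψ hΛ Sum.inl (fun m => Sum.inr (Sum.inr m)) (by simp),
      disjoint_range_coreChar hψ hΛ (fun m => Sum.inr (Sum.inl m)) (fun m => Sum.inr (Sum.inr m))
        (by simp),
      isFamily_coreChar hΛ _ Sum.inl_injective 1 (fun a => (hd a).1) _ ?_ _ ?_,
      isFamily_coreChar hΛ _ (Sum.inr_injective.comp Sum.inl_injective) 1
        (fun a => (hd a).2.1) _ ?_ _ ?_,
      isFamily_coreChar hΛ _ (Sum.inr_injective.comp Sum.inr_injective) (Nat.card F)
        (fun a => (hd a).2.2) _ ?_ _ ?_⟩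
    · rw [← range_coreChar hψ hΛ]
      ext χ
      simp only [Set.mem_range, Set.mem_union, Prod.exists, Sum.exists, or_assoc]
    · rw [Nat.card_prod, Nat.card_units]; ring
    · simp
    · rw [Nat.card_units]; ring
    · simp
    · rw [Nat.card_prod]; ring
    · field_simp
  · intro hp
    subst hp
    have h2 : (2 : F) = 0 := by exact_mod_cast CharP.cast_eq_zero F 2
    obtain ⟨τ, hτ⟩ : ∃ τ, phiChar 2 F τ ≠ 1 := by
      by_contra! h
      exact hψ (DFunLike.ext _ _ h)
    have hΛ : ∀ a : Fˣ, StabLabel.IsTransversal (phiChar 2 F) (a : F) (evenLabel τ a) :=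
      isTransversal_evenLabel hψ h2 (phiChar_sq F) hτ
    have hd := card_stab_evenLabel h2 τ
    refine ⟨_, _, _, _, ?_,
      disjoint_range_coreChar hψ hΛ Sum.inl (fun m => Sum.inr (Sum.inl m)) (by simp),
      disjoint_range_coreChar hψ hΛ Sum.inl (fun m => Sum.inr (Sum.inr (Sum.inl m))) (by simp),
      disjoint_range_coreChar hψ hΛ Sum.inl (fun m => Sum.inr (Sum.inr (Sum.inr m))) (by simp),
      disjoint_range_coreChar hψ hΛ (fun m => Sum.inr (Sum.inl m))
        (fun m => Sum.inr (Sum.inr (Sum.inl m))) (by simp),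
      disjoint_range_coreChar hψ hΛ (fun m => Sum.inr (Sum.inl m))
        (fun m => Sum.inr (Sum.inr (Sum.inr m))) (by simp),
      disjoint_range_coreChar hψ hΛ (fun m => Sum.inr (Sum.inr (Sum.inl m)))
        (fun m => Sum.inr (Sum.inr (Sum.inr m))) (by simp),
      isFamily_coreChar hΛ _ Sum.inl_injective 2 (fun a => (hd a).1) _ ?_ _ ?_,
      isFamily_coreChar hΛ _ (Sum.inr_injective.comp Sum.inl_injective) (Nat.card F)
        (fun a => (hd a).2.1) _ ?_ _ ?_,
      isFamily_coreChar hΛ _ (Sum.inr_injective.comp (Sum.inr_injective.comp Sum.inl_injective))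
        (Nat.card F) (fun a => (hd a).2.2.1) _ ?_ _ ?_,
      isFamily_coreChar hΛ _ (Sum.inr_injective.comp (Sum.inr_injective.comp Sum.inr_injective))
        (2 * Nat.card F) (fun a => (hd a).2.2.2) _ ?_ _ ?_⟩
    · rw [← range_coreChar hψ hΛ]
      ext χ
      simp only [Set.mem_range, Set.mem_union, Prod.exists, Sum.exists, or_assoc]
    · simp only [Nat.card_prod, Nat.card_units, Nat.card_zmod]; ring
    · simp
    · simp only [Nat.card_prod, Nat.card_units]; ring
    · field_simp
    · ring
    · field_simp
    · simp only [Nat.card_prod, Nat.card_units, Nat.card_zmod]; ring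
    · push_cast; field_simp
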